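/- Let $\omega_1,\omega_2,\gamma\in\mathbb{C}$ be such that $\delta=\omega_2/\omega_1$ satisfies ${\rm Im}\,\delta>0$ and $0<{\rm Im}\,\gamma<{\rm Im}\,\delta$. Let $$\zeta(z)=\frac1z+\sum_{(m,n)\in\mathbb{Z}^2\setminus\{(0,0)\}}\left\{\frac1{z-2m\omega_1-2n\omega_2}+\frac1{2m\omega_1+2n\omega_2}+\frac{z}{(2m\omega_1+2n\omega_2)^2}\right\}$$ be the Weierstrass zeta function, put $Z(u)=\zeta(2\omega_1u)$ and $(\Delta_\gamma Z)(u)=Z(u-\gamma)-2Z(u)+Z(u+\gamma)$, and consider, for functions $\eta(x,t)$ with $\eta(x+1,t)=\eta(x,t)$, $x\in\mathbb{R}$, the equation $$\frac{\partial}{\partial t}\eta(x,t)=\eta(x,t)\cdot\frac{i\omega_1}{\pi}\ \mathrm{p.v.}\!\!\int_{-1/2}^{1/2}(\Delta_\gamma Z)(y-x)\,\eta(y,t)\,dy,\qquad (\mathrm{ILW})$$ where p.v. is the Cauchy principal value at the points $y\in x+\mathbb{Z}$. For ${\rm Im}\,\Delta>0$ let $$\vartheta_1(u,\Delta)=-i\,e^{\pi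 i\Delta/4+\pi iu}\sum_{m\in\mathbb{Z}}(-1)^me^{\pi i\Delta m(m+1)+2\pi imu},$$ and let $\vartheta_1'$ denote its derivative in $u$. Let $\varepsilon,\Delta\in\mathbb{C}$ with ${\rm Im}\,\Delta>{\rm Im}\,\delta$ and let $k$ be a nonzero integer such that none of $k\gamma$, $k\delta$, $k(\delta-\gamma)$ lies in the lattice $\mathbb{Z}+\mathbb{Z}\Delta$, the zero set of $\vartheta_1(\cdot,\Delta)$ (this is automatic if $|k|=1$). Set $$\omega(k)=-\varepsilon\,\frac{\vartheta_1(k\gamma,\Delta)\,\vartheta_1(k(\delta-\gamma),\Delta)}{\vartheta_1'(0,\Delta)\,\vartheta_1(k\delta,\Delta)},\qquad \eta_0=\omega(k)\left(\frac{\vartheta_1'(k(\gamma-\delta),\Delta)}{\vartheta_1(k(\gamma-\delta),\Delta)}-\frac{\vartheta_1'(k\gamma,\Delta)}{\vartheta_1(k\gamma,\Delta)}\right),$$ $$\tau(x,t)=\vartheta_1(kx+\omega(k)t,\Delta),\qquad \eta(x,t)=\varepsilon\,\frac{\tau(x+\delta-\gamma,t)\,\tau(x+\gamma,t)}{\tau(x+\delta,t)\,\tau(x,t)}.$$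 (a) $\tau$ satisfies the bilinear equation: for all $x,t\in\mathbb{C}$, $$\partial_t\tau(x+\delta,t)\,\tau(x,t)-\tau(x+\delta,t)\,\partial_t\tau(x,t)=\varepsilon\,\tau(x+\delta-\gamma,t)\,\tau(x+\gamma,t)-\eta_0\,\tau(x+\delta,t)\,\tau(x,t).$$ (b) For every $t\in\mathbb{C}$ the function $z\mapsto\eta(z,t)$ is elliptic: it is meromorphic on $\mathbb{C}$ and has the periods $1$ and $\Delta/k$. (c) Let $U$ be the set of all $t\in\mathbb{C}$ for which $\tau(\cdot,t)$ has no zero in the closed strip $0\le{\rm Im}\,z\le{\rm Im}\,\delta$. For all $x\in\mathbb{R}$ and all $t\in U$ (in particular for all real $t\in U$), $\eta$ is analytic at $(x,t)$, $\eta(x+1,t)=\eta(x,t)$, the principal value exists, and $\eta$ satisfies (ILW) at $(x,t)$. The set $U$ is open, and it is nonempty if $\varepsilon\neq0$ and $|k|\,{\rm Im}\,\delta<{\rm Im}\,\Delta$. -/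

import Mathlib

open Complex Filter Topology MeasureTheory

namespace EllipticILW

noncomputable section

/-! ### The integro-differential equation -/

/-- The Weierstrass zeta function `ζ(z; 2ω₁, 2ω₂)` with half-periods `ω₁, ω₂`. -/
def weierstrassZeta (ω₁ ω₂ z : ℂ) : ℂ :=
  1 / z + ∑' v : {v : ℤ × ℤ // v ≠ 0},
    (1 / (z - (2 * v.1.1 * ω₁ + 2 * v.1.2 * ω₂)) + 1 / (2 * v.1.1 * ω₁ + 2 * v.1.2 * ω₂)
      + z / (2 * v.1.1 * ω₁ + 2 * v.1.2 * ω₂) ^ 2)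

/-- The discrete Laplacian `(Δ_γ f)(u) = f(u - γ) - 2 f(u) + f(u + γ)`. -/
def discreteLaplacian (γ : ℂ) (f : ℂ → ℂ) (u : ℂ) : ℂ :=
  f (u - γ) - 2 * f u + f (u + γ)

/-- The kernel: the second difference, with step `γ`, of the function `u ↦ ζ(2ω₁u; 2ω₁, 2ω₂)`
(which has periods `1` and `δ = ω₂/ω₁` up to additive constants). -/
def kernel (ω₁ ω₂ γ u : ℂ) : ℂ :=
  discreteLaplacian γ (fun s => weierstrassZeta ω₁ ω₂ (2 * ω₁ * s)) u

/-- The interval `[-1/2, 1/2]` with the `r`-neighbourhoods of the points `x + n`, `n ∈ ℤ`,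
taken out. -/
def truncatedPeriod (x r : ℝ) : Set ℝ :=
  {y | y ∈ Set.Icc (-1 / 2 : ℝ) (1 / 2) ∧ ∀ n : ℤ, r ≤ |y - (x + n)|}

/-- `v` is the Cauchy principal value of `∫_{-1/2}^{1/2} f(y) dy`, for a function `f` of period `1`
whose singularities are at the points `x + n`, `n ∈ ℤ`. -/
def HasPrincipalValue (x : ℝ) (f : ℝ → ℂ) (v : ℂ) : Prop :=
  (∀ r : ℝ, 0 < r → IntegrableOn f (truncatedPeriod x r)) ∧
    Tendsto (fun r : ℝ => ∫ y in truncatedPeriod x r, f y) (𝓝[>] 0) (𝓝 v)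

/-- `(𝖳 f)(x) = (i ω₁ / π) PV ∫_{-1/2}^{1/2} (Δ_γ ζ)(2ω₁(y - x)) f(y) dy` exists
and equals `v`. -/
def HasTransform (ω₁ ω₂ γ : ℂ) (f : ℝ → ℂ) (x : ℝ) (v : ℂ) : Prop :=
  ∃ p : ℂ, HasPrincipalValue x (fun y : ℝ => kernel ω₁ ω₂ γ ((y : ℂ) - (x : ℂ)) * f y) p ∧
    v = I * ω₁ / (Real.pi : ℂ) * p

/-- `η(x, t)` is an analytic solution, of period `1` in the real variable `x`, of
`∂η/∂t = η · 𝖳 η`, for all real `x` and all times `t` in `U`. Times may be complex; at a real time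
the complex derivative in `t` is in particular the real one. -/
structure IsILWSolution (ω₁ ω₂ γ : ℂ) (U : Set ℂ) (η : ℝ → ℂ → ℂ) : Prop where
  analytic : ∀ x : ℝ, ∀ t ∈ U, AnalyticAt ℝ (fun p : ℝ × ℂ => η p.1 p.2) (x, t)
  periodic : ∀ x : ℝ, ∀ t ∈ U, η (x + 1) t = η x t
  equation : ∀ x : ℝ, ∀ t ∈ U, ∃ v : ℂ,
    HasTransform ω₁ ω₂ γ (fun y => η y t) x v ∧ HasDerivAt (η x) (η x t * v) t

/-! ### The bilinear equation -/

/-- The Hirota derivative `D_t f · g = (∂_t f) g - f (∂_t g)`. -/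
def hirotaD (f g : ℂ → ℂ) (t : ℂ) : ℂ := deriv f t * g t - f t * deriv g t

/-- `D_t τ(x+δ) · τ(x) = ε τ(x+δ-γ) τ(x+γ) - η₀ τ(x+δ) τ(x)`. -/
structure IsBilinearSolution (γ δ ε η₀ : ℂ) (τ : ℂ → ℂ → ℂ) : Prop where
  differentiable : ∀ x : ℂ, Differentiable ℂ (τ x)
  equation : ∀ x t : ℂ, hirotaD (τ (x + δ)) (τ x) t
    = ε * (τ (x + δ - γ) t * τ (x + γ) t) - η₀ * (τ (x + δ) t * τ x t)

/-! ### The theta function and the elliptic solution -/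

/-- The theta function `ϑ₁(u, Δ)`. -/
def theta1 (u Δ : ℂ) : ℂ :=
  -I * exp (Real.pi * I * Δ / 4 + Real.pi * I * u) *
    ∑' m : ℤ, (-1 : ℂ) ^ m * exp (Real.pi * I * Δ * m * (m + 1) + 2 * Real.pi * I * m * u)

/-- The derivative `ϑ₁'(u, Δ)` in `u`. -/
def theta1' (u Δ : ℂ) : ℂ := deriv (fun s => theta1 s Δ) u

/-- The frequency `ω(k)`. -/
def omega (γ δ ε Δ : ℂ) (k : ℤ) : ℂ :=
  -ε * (theta1 (k * γ) Δ * theta1 (k * (δ - γ)) Δ / (theta1' 0 Δ * theta1 (k * δ) Δ))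

/-- The constant `η₀`. -/
def etaZero (γ δ ε Δ : ℂ) (k : ℤ) : ℂ :=
  omega γ δ ε Δ k * (theta1' (k * (γ - δ)) Δ / theta1 (k * (γ - δ)) Δ
    - theta1' (k * γ) Δ / theta1 (k * γ) Δ)

/-- `τ(x, t) = ϑ₁(k x + ω(k) t, Δ)`. -/
def tau (γ δ ε Δ : ℂ) (k : ℤ) (x t : ℂ) : ℂ := theta1 (k * x + omega γ δ ε Δ k * t) Δ

/-- `η(x, t) = ε τ(x+δ-γ) τ(x+γ) / (τ(x+δ) τ(x))`. -/
def eta (γ δ ε Δ : ℂ) (k : ℤ) (x t : ℂ) : ℂ :=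
  ε * (tau γ δ ε Δ k (x + δ - γ) t * tau γ δ ε Δ k (x + γ) t
    / (tau γ δ ε Δ k (x + δ) t * tau γ δ ε Δ k x t))

/-- The times `t` at which `τ(·, t)` has no zero in the closed strip `0 ≤ Im z ≤ Im δ`, so that
`w = -∂_t τ / τ` is holomorphic on a neighbourhood of that strip. -/
def regularTimes (δ : ℂ) (τ : ℂ → ℂ → ℂ) : Set ℂ :=
  {t | ∀ z : ℂ, 0 ≤ z.im → z.im ≤ δ.im → τ z t ≠ 0}

end

end EllipticILW

/-! Put `w = -∂_t τ / τ`. Dividing the bilinear equation by `τ(x+δ) τ(x)` gives `η = w(x) - w(x+δ) +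
η₀`, while the logarithmic `t`-derivative of `η` is `w(x) + w(x+δ) - w(x+γ) - w(x+δ-γ)`. So (ILW)
follows once the transform of `w - w(· + δ) + c` is shown to be exactly this four-term expression
(`hasTransform_sub_shift`), for any 1-periodic `w` holomorphic on the closed strip. That formula is
a residue computation. The second difference removes the additive quasi-periods of `ζ`, so the
kernel `K` is elliptic with periods `1`, `δ`, and the integral of `K(y-x)(w(y) - w(y+δ))` is a
contour integral of `K(z-x) w(z)` around a strip of width one. The poles `x+γ`, `x+δ-γ` lie inside
and count fully; `x`, `x+δ` lie on the edges and count half, by the principal value, but carry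
weight `-2`. The constant `c` contributes nothing because `K` is odd. In place of a residue theorem,
multiples of `π cot` with the same poles are subtracted (`polarPart`): the remainder has equal
integrals along both edges, and the cotangents are integrated by hand. The bilinear equation is an
addition formula for `ϑ₁` (`theta1_bilinear`), proved by Liouville: the difference of the two sides,
divided by `ϑ₁(u+a) ϑ₁(u)`, is elliptic without poles, and it vanishes at one point. This needs the
zeros of `ϑ₁` to be simple and to be just the lattice, which is read off from an infinite product
with the same quasi-periods (`exists_theta1_eq_mul_thetaProd`). -/

namespace EllipticILW

/-! ### Simple poles -/

/-- `f` has at most a simple pole at `p`, with residue `c`. -/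
def HasSimplePole (f : ℂ → ℂ) (p c : ℂ) : Prop :=
  ∃ A : ℂ → ℂ, AnalyticAt ℂ A p ∧ ∀ᶠ z in 𝓝[≠] p, f z = c / (z - p) + A z

theorem HasSimplePole.of_analyticAt {f : ℂ → ℂ} {p : ℂ} (hf : AnalyticAt ℂ f p) :
    HasSimplePole f p 0 :=
  ⟨f, hf, by simp⟩

theorem HasSimplePole.congr {f g : ℂ → ℂ} {p c : ℂ} (hf : HasSimplePole f p c)
    (h : ∀ᶠ z in 𝓝[≠] p, g z = f z) : HasSimplePole g p c := by
  obtain ⟨A, hA, h'⟩ := hf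
  exact ⟨A, hA, by filter_upwards [h, h'] with z h1 h2 using h1.trans h2⟩

theorem HasSimplePole.add {f g : ℂ → ℂ} {p c d : ℂ} (hf : HasSimplePole f p c)
    (hg : HasSimplePole g p d) : HasSimplePole (fun z => f z + g z) p (c + d) := by
  obtain ⟨A, hA, h⟩ := hf
  obtain ⟨B, hB, h'⟩ := hg
  refine ⟨fun z => A z + B z, hA.add hB, ?_⟩
  filter_upwards [h, h'] with z h1 h2
  rw [h1, h2]; ring

theorem HasSimplePole.mul_analyticAt {f g : ℂ → ℂ} {p c : ℂ} (hf : HasSimplePole f p c)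
    (hg : AnalyticAt ℂ g p) : HasSimplePole (fun z => f z * g z) p (c * g p) := by
  obtain ⟨A, hA, h⟩ := hf
  obtain ⟨s, hs⟩ := hg
  have hd : AnalyticAt ℂ (dslope g p) p :=
    ⟨_, hs.has_fpower_series_dslope_fslope⟩
  refine ⟨fun z => c * dslope g p z + A z * g z, by
    have hg : AnalyticAt ℂ g p := ⟨s, hs⟩
    fun_prop, ?_⟩
  filter_upwards [h, self_mem_nhdsWithin] with z h1 hz
  have hz' : z - p ≠ 0 := sub_ne_zero.2 hz
  rw [h1, dslope_of_ne _ hz, slope_def_field]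
  field_simp
  ring

theorem HasSimplePole.const_mul {f : ℂ → ℂ} {p c : ℂ} (hf : HasSimplePole f p c) (a : ℂ) :
    HasSimplePole (fun z => a * f z) p (a * c) := by
  simpa [mul_comm] using hf.mul_analyticAt (g := fun _ => a) analyticAt_const

theorem HasSimplePole.sub {f g : ℂ → ℂ} {p c d : ℂ} (hf : HasSimplePole f p c)
    (hg : HasSimplePole g p d) : HasSimplePole (fun z => f z - g z) p (c - d) := by
  simpa [sub_eq_add_neg] using hf.add (hg.const_mul (-1))

theorem tendsto_affine_punctured {a : ℂ} (ha : a ≠ 0) (b p : ℂ) :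
    Tendsto (fun z => a * z + b) (𝓝[≠] p) (𝓝[≠] (a * p + b)) := by
  refine tendsto_nhdsWithin_iff.2 ⟨?_, ?_⟩
  · exact (Continuous.tendsto (by fun_prop) p).mono_left nhdsWithin_le_nhds
  · filter_upwards [self_mem_nhdsWithin] with z hz
    simpa [ha] using hz

theorem HasSimplePole.comp_affine {f : ℂ → ℂ} {p c a b : ℂ} (ha : a ≠ 0)
    (hf : HasSimplePole f (a * p + b) c) : HasSimplePole (fun z => f (a * z + b)) p (c / a) := by
  obtain ⟨A, hA, h⟩ := hf
  refine ⟨fun z => A (a * z + b), AnalyticAt.fun_comp hA (by fun_prop), ?_⟩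
  filter_upwards [(tendsto_affine_punctured ha b p).eventually h, self_mem_nhdsWithin] with z h1 hz
  have hz' : z - p ≠ 0 := sub_ne_zero.2 hz
  rw [h1, show a * z + b - (a * p + b) = a * (z - p) by ring]
  field_simp

theorem HasSimplePole.comp_add {f : ℂ → ℂ} {p c b : ℂ}
    (hf : HasSimplePole f (p + b) c) : HasSimplePole (fun z => f (z + b)) p c := by
  simpa using HasSimplePole.comp_affine (a := 1) (b := b) (p := p) one_ne_zero (by simpa using hf)

/-- Near `p` one has `g z = (z - p) * dslope g p z`, with `dslope g p` analytic and nonzero at `p`.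
If `f` also vanishes at `p`, the residue is zero and the singularity removable. -/
theorem HasSimplePole.div_of_simple_zero {f g : ℂ → ℂ} {p : ℂ} (hf : AnalyticAt ℂ f p)
    (hg : AnalyticAt ℂ g p) (h0 : g p = 0) (h1 : deriv g p ≠ 0) :
    HasSimplePole (fun z => f z / g z) p (f p / deriv g p) := by
  obtain ⟨s, hs⟩ := hg
  have hd : AnalyticAt ℂ (dslope g p) p := ⟨_, hs.has_fpower_series_dslope_fslope⟩
  have hne : dslope g p p ≠ 0 := by rwa [dslope_same]
  have hp : HasSimplePole (fun z => 1 / (z - p)) p 1 := ⟨fun _ => 0, analyticAt_const, by simp⟩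
  have := hp.mul_analyticAt (hf.fun_div hd hne)
  rw [dslope_same, one_mul] at this
  refine this.congr ?_
  filter_upwards [self_mem_nhdsWithin] with z hz
  have hz' : z - p ≠ 0 := sub_ne_zero.2 hz
  rw [dslope_of_ne _ hz, slope_def_field, h0, sub_zero]
  field_simp

/-- The function `f` with its removable singularities removed. -/
noncomputable def regularize (f : ℂ → ℂ) (z : ℂ) : ℂ := limUnder (𝓝[≠] z) f

theorem regularize_eq_of_eventuallyEq {f A : ℂ → ℂ} {z : ℂ} (hA : ContinuousAt A z)
    (h : ∀ᶠ y in 𝓝[≠] z, f y = A y) : regularize f z = A z := by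
  refine Tendsto.limUnder_eq ?_
  exact (hA.tendsto.mono_left nhdsWithin_le_nhds).congr' (by
    filter_upwards [h] with y hy using hy.symm)

theorem regularize_eq_self {f : ℂ → ℂ} {z : ℂ} (hf : ContinuousAt f z) : regularize f z = f z :=
  regularize_eq_of_eventuallyEq hf (by simp)

theorem HasSimplePole.analyticAt_regularize {f : ℂ → ℂ} {p : ℂ} (hf : HasSimplePole f p 0) :
    AnalyticAt ℂ (regularize f) p := by
  obtain ⟨A, hA, h⟩ := hf
  replace h : ∀ᶠ z in 𝓝[≠] p, f z = A z := by simpa using h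
  refine hA.congr ?_
  have h2 := eventually_eventually_nhdsWithin.2 h
  have h3 := eventually_nhdsWithin_iff.1 h2
  filter_upwards [h3, hA.eventually_analyticAt] with z hz hAz
  by_cases hzp : z = p
  · subst hzp
    exact (regularize_eq_of_eventuallyEq hA.continuousAt h).symm
  · refine (regularize_eq_of_eventuallyEq hAz.continuousAt ?_).symm
    have := hz hzp
    have h4 : 𝓝[{p}ᶜ] z = 𝓝 z := (isOpen_compl_singleton).nhdsWithin_eq hzp
    rw [h4] at this
    exact this.filter_mono nhdsWithin_le_nhds

/-- Only the punctured germ of `f` matters, so periodicity off the poles suffices and values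
assigned by division by zero are harmless. -/
theorem regularize_add_of_periodic {f : ℂ → ℂ} {a z : ℂ}
    (hf : ∀ᶠ y in 𝓝[≠] z, f (y + a) = f y) :
    regularize f (z + a) = regularize f z := by
  have : 𝓝[≠] (z + a) = map (fun y => y + a) (𝓝[≠] z) := by
    have := (Homeomorph.addRight a).isEmbedding.map_nhdsWithin_eq {z}ᶜ z
    simp only [Homeomorph.coe_addRight] at this
    rw [this]
    congr 1
    ext y
    simp
  unfold regularize limUnder
  rw [this, Filter.map_map]
  exact congrArg lim (Filter.map_congr hf)

/-! ### Quasi-periodic entire functions -/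

theorem exists_lattice_reduction {Δ : ℂ} (hΔ : 0 < Δ.im) (z : ℂ) :
    ∃ m n : ℤ, ∃ a ∈ Set.Icc (0 : ℝ) 1, ∃ b ∈ Set.Icc (0 : ℝ) 1,
      z = (a + b * Δ) + (m + n * Δ) := by
  set b := z.im / Δ.im with hb
  set a := z.re - b * Δ.re with ha
  refine ⟨⌊a⌋, ⌊b⌋, Int.fract a, ⟨Int.fract_nonneg _, (Int.fract_lt_one _).le⟩,
    Int.fract b, ⟨Int.fract_nonneg _, (Int.fract_lt_one _).le⟩, ?_⟩
  have h1 : ((Int.fract a : ℝ) : ℂ) + (⌊a⌋ : ℂ) = a := by exact_mod_cast Int.fract_add_floor a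
  have h2 : ((Int.fract b : ℝ) : ℂ) + (⌊b⌋ : ℂ) = b := by exact_mod_cast Int.fract_add_floor b
  have : z = a + b * Δ := by
    apply Complex.ext
    · simp [ha]
    · simp [hb, hΔ.ne']
  rw [this]
  linear_combination -h1 - Δ * h2

/-- The target type is arbitrary so that `H` may also be a predicate, such as vanishing or having a
simple zero. -/
theorem apply_add_lattice {X : Type*} {H : ℂ → X} {Δ : ℂ} (h1 : ∀ z, H (z + 1) = H z)
    (h2 : ∀ z, H (z + Δ) = H z) (z : ℂ) (m n : ℤ) : H (z + (m + n * Δ)) = H z := by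
  have a1 := Function.Periodic.int_mul (f := H) (c := 1) h1 m
  have a2 := Function.Periodic.int_mul (f := H) (c := Δ) h2 n
  rw [← add_assoc, a2, show (m : ℂ) = m * 1 by ring, a1]

/-- Liouville's theorem: all values are already taken on the compact period parallelogram. -/
theorem exists_eq_of_doublyPeriodic {H : ℂ → ℂ} {Δ : ℂ} (hΔ : 0 < Δ.im)
    (hH : Differentiable ℂ H) (h1 : ∀ z, H (z + 1) = H z) (h2 : ∀ z, H (z + Δ) = H z) :
    ∃ c, ∀ z, H z = c := by
  refine hH.exists_const_forall_eq_of_bounded ?_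
  have hK : IsCompact ((fun p : ℝ × ℝ => H (p.1 + p.2 * Δ)) ''
      (Set.Icc (0 : ℝ) 1 ×ˢ Set.Icc (0 : ℝ) 1)) := by
    refine (isCompact_Icc.prod isCompact_Icc).image ?_
    have := hH.continuous
    fun_prop
  refine hK.isBounded.subset ?_
  rintro _ ⟨z, rfl⟩
  obtain ⟨m, n, a, ha, b, hb, rfl⟩ := exists_lattice_reduction hΔ z
  exact ⟨(a, b), ⟨ha, hb⟩, (apply_add_lattice h1 h2 _ m n).symm⟩

/-- The multipliers cancel in `f / g`, and each simple zero of `g` is absorbed by a zero of `f`; the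
regularized quotient is entire and doubly periodic, hence constant. -/
theorem exists_eq_mul_of_quasiPeriodic {f g e₁ e₂ : ℂ → ℂ} {Δ : ℂ} (hΔ : 0 < Δ.im)
    (hf : Differentiable ℂ f) (hg : Differentiable ℂ g)
    (he₁ : ∀ z, e₁ z ≠ 0) (he₂ : ∀ z, e₂ z ≠ 0)
    (hf₁ : ∀ z, f (z + 1) = e₁ z * f z) (hg₁ : ∀ z, g (z + 1) = e₁ z * g z)
    (hf₂ : ∀ z, f (z + Δ) = e₂ z * f z) (hg₂ : ∀ z, g (z + Δ) = e₂ z * g z)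
    (hfg : ∀ z, g z = 0 → f z = 0) (hg' : ∀ z, g z = 0 → deriv g z ≠ 0) :
    ∃ c, ∀ z, f z = c * g z := by
  set h : ℂ → ℂ := fun z => f z / g z with hh
  have hp : ∀ z, HasSimplePole h z 0 := by
    intro z
    by_cases hz : g z = 0
    · simpa [hfg z hz] using
        HasSimplePole.div_of_simple_zero (hf.analyticAt z) (hg.analyticAt z) hz (hg' z hz)
    · exact .of_analyticAt ((hf.analyticAt z).fun_div (hg.analyticAt z) hz)
  obtain ⟨c, hc⟩ := exists_eq_of_doublyPeriodic (H := regularize h) hΔ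
    (fun z => (hp z).analyticAt_regularize.differentiableAt)
    (fun z => regularize_add_of_periodic <| .of_forall fun z => by
      simp only [hh, hf₁, hg₁, mul_div_mul_left _ _ (he₁ z)])
    (fun z => regularize_add_of_periodic <| .of_forall fun z => by
      simp only [hh, hf₂, hg₂, mul_div_mul_left _ _ (he₂ z)])
  refine ⟨c, fun z => ?_⟩
  by_cases hz : g z = 0
  · rw [hfg z hz, hz, mul_zero]
  · have := hc z
    rw [regularize_eq_self ((hf.analyticAt z).fun_div (hg.analyticAt z) hz).continuousAt] at this
    rw [← this]
    field_simp

/-! ### An infinite product with zeros on a lattice -/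

/-- The product `∏ (1 - q ^ n x)` over `n ≥ 0`. -/
noncomputable def qProd (q x : ℂ) : ℂ := ∏' n : ℕ, (1 + -(q ^ n * x))

theorem summable_norm_pow_mul {q : ℂ} (hq : ‖q‖ < 1) (x : ℂ) :
    Summable fun n : ℕ => ‖-(q ^ n * x)‖ := by
  simpa [norm_neg, norm_mul, norm_pow] using
    (summable_geometric_of_lt_one (norm_nonneg q) hq).mul_right ‖x‖

theorem differentiable_qProd {q : ℂ} (hq : ‖q‖ < 1) : Differentiable ℂ (qProd q) := by
  intro x
  have hu : Summable fun n : ℕ => ‖q‖ ^ n * (‖x‖ + 1) :=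
    (summable_geometric_of_lt_one (norm_nonneg q) hq).mul_right _
  have h := Summable.hasProdLocallyUniformlyOn_nat_one_add (f := fun (n : ℕ) (y : ℂ) => -(q ^ n * y))
    (K := Metric.ball (0 : ℂ) (‖x‖ + 1)) Metric.isOpen_ball hu
    (Eventually.of_forall fun n y hy => by
      rw [mem_ball_zero_iff] at hy
      rw [norm_neg, norm_mul, norm_pow]
      gcongr) (fun n => by fun_prop)
  have h2 := h.differentiableOn (.of_forall fun s => by
    simpa [Finset.prod_fn] using
      DifferentiableOn.finsetProd (fun _ _ => by fun_prop)) Metric.isOpen_ball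
  exact h2.differentiableAt (Metric.isOpen_ball.mem_nhds (by simp))

theorem qProd_eq_mul {q : ℂ} (hq : ‖q‖ < 1) (x : ℂ) :
    qProd q x = (1 - x) * qProd q (q * x) := by
  have h := multipliable_one_add_of_summable (summable_norm_pow_mul hq (q * x))
  have e : ∀ n : ℕ, 1 + -(q ^ n * (q * x)) = 1 + -(q ^ (n + 1) * x) := fun n => by ring
  have h' : Multipliable fun n : ℕ => 1 + -(q ^ (n + 1) * x) := h.congr e
  unfold qProd
  refine (tprod_eq_zero_mul' (f := fun n : ℕ => 1 + -(q ^ n * x)) h').trans ?_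
  rw [tprod_congr e, pow_zero, one_mul, sub_eq_add_neg]

theorem exists_of_qProd_eq_zero {q x : ℂ} (hq : ‖q‖ < 1) (h : qProd q x = 0) :
    ∃ n : ℕ, q ^ n * x = 1 := by
  by_contra! hne
  refine tprod_one_add_ne_zero_of_summable (f := fun n : ℕ => -(q ^ n * x)) (fun n hn => ?_)
    (summable_norm_pow_mul hq x) h
  exact hne n (by linear_combination -hn)

theorem qProd_self_ne_zero {q : ℂ} (hq : ‖q‖ < 1) : qProd q q ≠ 0 := by
  intro h
  obtain ⟨n, hn⟩ := exists_of_qProd_eq_zero hq h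
  have h1 : ‖q‖ ^ (n + 1) = 1 := by rw [← norm_pow, pow_succ, hn, norm_one]
  exact (pow_lt_one₀ (norm_nonneg q) hq n.succ_ne_zero).ne h1

/-- The product side of the triple product formula for `ϑ₁`, up to a constant factor. -/
noncomputable def thetaProd (Δ u : ℂ) : ℂ :=
  exp (-(Real.pi * I * u)) * qProd (exp (2 * Real.pi * I * Δ)) (exp (2 * Real.pi * I * u)) *
    qProd (exp (2 * Real.pi * I * Δ)) (exp (2 * Real.pi * I * (Δ - u)))

theorem norm_nome_lt_one {Δ : ℂ} (hΔ : 0 < Δ.im) : ‖exp (2 * Real.pi * I * Δ)‖ < 1 := by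
  rw [norm_exp, Real.exp_lt_one_iff]
  have : (2 * Real.pi * I * Δ).re = -(2 * Real.pi * Δ.im) := by simp
  rw [this]
  have := Real.pi_pos
  nlinarith [mul_pos this hΔ]

theorem exp_add_two_pi_mul (a : ℂ) : exp (2 * Real.pi * I * (a + 1)) = exp (2 * Real.pi * I * a) := by
  rw [mul_add, mul_one, exp_add, exp_two_pi_mul_I, mul_one]

theorem neg_exp_eq (a : ℂ) : -exp a = exp (Real.pi * I + a) := by
  rw [exp_add, exp_pi_mul_I, neg_one_mul]

theorem exp_two_pi_mul_eq_one_iff {u : ℂ} :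
    exp (2 * Real.pi * I * u) = 1 ↔ ∃ n : ℤ, u = n := by
  rw [exp_eq_one_iff]
  refine exists_congr fun n => ?_
  have : (2 * Real.pi * I : ℂ) ≠ 0 := two_pi_I_ne_zero
  rw [mul_comm (n : ℂ)]
  exact mul_right_inj' this

theorem differentiable_thetaProd {Δ : ℂ} (hΔ : 0 < Δ.im) : Differentiable ℂ (thetaProd Δ) := by
  have := differentiable_qProd (norm_nome_lt_one hΔ)
  unfold thetaProd
  fun_prop

theorem thetaProd_add_one (Δ u : ℂ) : thetaProd Δ (u + 1) = -1 * thetaProd Δ u := by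
  have h1 : exp (2 * Real.pi * I * (Δ - (u + 1))) = exp (2 * Real.pi * I * (Δ - u)) := by
    rw [← exp_add_two_pi_mul]; ring_nf
  have h2 : exp (-(Real.pi * I * (u + 1))) = -exp (-(Real.pi * I * u)) := by
    rw [show -(Real.pi * I * (u + 1)) = -(Real.pi * I * u) + -(Real.pi * I) by ring, exp_add,
      exp_neg (Real.pi * I), exp_pi_mul_I]
    norm_num
  simp only [thetaProd, exp_add_two_pi_mul, h1, h2]
  ring

/-- The shift moves one factor from one product to the other: it removes `1 - e^{2πiu}` and creates
`1 - e^{-2πiu}`, whose ratio is a pure exponential. -/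
theorem thetaProd_add_period {Δ : ℂ} (hΔ : 0 < Δ.im) (u : ℂ) :
    thetaProd Δ (u + Δ) = -exp (-(Real.pi * I * Δ) - 2 * Real.pi * I * u) * thetaProd Δ u := by
  have hq := norm_nome_lt_one hΔ
  have e1 : exp (2 * Real.pi * I * (u + Δ)) =
      exp (2 * Real.pi * I * Δ) * exp (2 * Real.pi * I * u) := by
    rw [← exp_add]; ring_nf
  have e2 : exp (2 * Real.pi * I * (Δ - u)) =
      exp (2 * Real.pi * I * Δ) * exp (2 * Real.pi * I * -u) := by
    rw [← exp_add]; ring_nf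
  have e3 : exp (-(Real.pi * I * (u + Δ))) * exp (2 * Real.pi * I * u) =
      exp (-(Real.pi * I * Δ) - 2 * Real.pi * I * u) * exp (-(Real.pi * I * u)) *
        exp (2 * Real.pi * I * u) * exp (2 * Real.pi * I * u) := by
    simp only [← exp_add]; ring_nf
  have e4 : exp (2 * Real.pi * I * -u) * exp (2 * Real.pi * I * u) = 1 := by
    rw [← exp_add]; ring_nf; simp
  have hne : exp (2 * Real.pi * I * u) ≠ 0 := exp_ne_zero _
  -- Multiplying by `e^{2πiu}` clears the negative exponential and makes the claim polynomial in the
  -- generalized quantities.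
  refine mul_right_cancel₀ hne ?_
  simp only [thetaProd, show Δ - (u + Δ) = -u by ring, e1]
  rw [qProd_eq_mul hq (exp (2 * Real.pi * I * u)), qProd_eq_mul hq (exp (2 * Real.pi * I * -u)),
    ← e2]
  generalize qProd (exp (2 * Real.pi * I * Δ)) (exp (2 * Real.pi * I * Δ) *
    exp (2 * Real.pi * I * u)) = A
  generalize qProd (exp (2 * Real.pi * I * Δ)) (exp (2 * Real.pi * I * (Δ - u))) = B
  generalize exp (-(Real.pi * I * (u + Δ))) = x at *
  generalize exp (-(Real.pi * I * Δ) - 2 * Real.pi * I * u) = y at *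
  generalize exp (-(Real.pi * I * u)) = w at *
  generalize exp (2 * Real.pi * I * -u) = v at *
  generalize exp (2 * Real.pi * I * u) = e at *
  have e5 : x = y * w * e := mul_right_cancel₀ hne (by rw [e3])
  rw [e5]
  linear_combination (-(y * w * e * A * B)) * e4

theorem exists_of_thetaProd_eq_zero {Δ u : ℂ} (hΔ : 0 < Δ.im) (h : thetaProd Δ u = 0) :
    ∃ m n : ℤ, u = m + n * Δ := by
  have hq := norm_nome_lt_one hΔ
  have key : ∀ v : ℂ, qProd (exp (2 * Real.pi * I * Δ)) (exp (2 * Real.pi * I * v)) = 0 →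
      ∃ m n : ℤ, v = m + n * Δ := by
    intro v hv
    obtain ⟨n, hn⟩ := exists_of_qProd_eq_zero hq hv
    rw [← exp_nat_mul, ← exp_add, show (n : ℂ) * (2 * Real.pi * I * Δ) + 2 * Real.pi * I * v =
      2 * Real.pi * I * (n * Δ + v) by ring, exp_two_pi_mul_eq_one_iff] at hn
    obtain ⟨m, hm⟩ := hn
    exact ⟨m, -n, by push_cast; linear_combination hm⟩
  rcases mul_eq_zero.1 h with h | h
  · rcases mul_eq_zero.1 h with h | h
    · exact absurd h (exp_ne_zero _)
    · exact key u h
  · obtain ⟨m, n, hmn⟩ := key _ h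
    exact ⟨-m, 1 - n, by push_cast; linear_combination -hmn⟩

/-- With the factor `1 - e^{2πiu}` split off, the cofactor takes the value `qProd q q ^ 2 ≠ 0` at
`0`. -/
theorem thetaProd_zero_simple {Δ : ℂ} (hΔ : 0 < Δ.im) :
    thetaProd Δ 0 = 0 ∧ deriv (thetaProd Δ) 0 ≠ 0 := by
  have hq := norm_nome_lt_one hΔ
  have hA := differentiable_qProd hq
  set q := exp (2 * Real.pi * I * Δ) with hqdef
  have h1 : thetaProd Δ = fun u => (1 - exp (2 * Real.pi * I * u)) *
      (exp (-(Real.pi * I * u)) * qProd q (q * exp (2 * Real.pi * I * u)) *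
        qProd q (exp (2 * Real.pi * I * (Δ - u)))) := by
    ext u
    rw [thetaProd, ← hqdef, qProd_eq_mul hq (exp (2 * Real.pi * I * u))]
    ring
  have h2 : HasDerivAt (fun u : ℂ => 1 - exp (2 * Real.pi * I * u)) (-(2 * Real.pi * I)) 0 := by
    have := (((hasDerivAt_id (0 : ℂ)).const_mul (2 * Real.pi * I)).cexp).const_sub 1
    simpa using this
  have h3 : DifferentiableAt ℂ (fun u => exp (-(Real.pi * I * u)) *
      qProd q (q * exp (2 * Real.pi * I * u)) * qProd q (exp (2 * Real.pi * I * (Δ - u)))) 0 := by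
    fun_prop
  have h4 := h2.mul h3.hasDerivAt
  refine ⟨by rw [h1]; simp, ?_⟩
  rw [h1]
  have h5 := h4.deriv
  simp only [Pi.mul_def] at h5
  rw [h5]
  simp only [mul_zero, exp_zero, sub_self, zero_mul, add_zero, mul_one, neg_zero, one_mul,
    sub_zero, ← hqdef]
  exact mul_ne_zero (neg_ne_zero.2 two_pi_I_ne_zero)
    (mul_ne_zero (qProd_self_ne_zero hq) (qProd_self_ne_zero hq))

/-- At a zero of `F` the term with the derivative of `e` drops out. This carries simplicity from `0`
to the whole lattice. -/
theorem simple_zero_add_iff {F e : ℂ → ℂ} {a : ℂ} (hF : Differentiable ℂ F)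
    (he : Differentiable ℂ e) (he0 : ∀ z, e z ≠ 0) (h : ∀ z, F (z + a) = e z * F z) (z : ℂ) :
    (F (z + a) = 0 ∧ deriv F (z + a) ≠ 0) ↔ (F z = 0 ∧ deriv F z ≠ 0) := by
  rw [h, mul_eq_zero, or_iff_right (he0 z)]
  refine and_congr_right fun hz => ?_
  have h1 : deriv F (z + a) = e z * deriv F z := by
    rw [← deriv_comp_add_const, show (fun x => F (x + a)) = fun x => e x * F x from funext h,
      deriv_fun_mul (he z) (hF z), hz, mul_zero, zero_add]
  simp [h1, he0 z]

theorem deriv_thetaProd_ne_zero {Δ u : ℂ} (hΔ : 0 < Δ.im) (h : thetaProd Δ u = 0) :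
    deriv (thetaProd Δ) u ≠ 0 := by
  obtain ⟨m, n, rfl⟩ := exists_of_thetaProd_eq_zero hΔ h
  have hd := differentiable_thetaProd hΔ
  have := apply_add_lattice (H := fun z => (thetaProd Δ z = 0 ∧ deriv (thetaProd Δ) z ≠ 0))
    (fun z => propext (simple_zero_add_iff hd (e := fun _ => -1) (by fun_prop) (by simp)
      (thetaProd_add_one Δ) z))
    (fun z => propext (simple_zero_add_iff hd (by fun_prop) (by simp)
      (thetaProd_add_period hΔ) z)) 0 m n
  rw [zero_add] at this
  exact (this.mpr (thetaProd_zero_simple hΔ)).2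

/-! ### The theta function -/

theorem theta1_eq_jacobiTheta₂ (u Δ : ℂ) :
    theta1 u Δ = -I * exp (Real.pi * I * Δ / 4 + Real.pi * I * u) *
      jacobiTheta₂ (u + (1 + Δ) / 2) Δ := by
  unfold theta1 jacobiTheta₂
  congr 1
  refine tsum_congr fun m => ?_
  rw [jacobiTheta₂_term, ← exp_pi_mul_I, ← exp_int_mul, ← exp_add]
  ring_nf

theorem differentiable_theta1 {Δ : ℂ} (hΔ : 0 < Δ.im) :
    Differentiable ℂ (fun u => theta1 u Δ) := by
  simp only [theta1_eq_jacobiTheta₂]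
  have : Differentiable ℂ fun z => jacobiTheta₂ z Δ :=
    fun z => differentiableAt_jacobiTheta₂_fst z hΔ
  fun_prop

theorem theta1_add_one (u Δ : ℂ) : theta1 (u + 1) Δ = -1 * theta1 u Δ := by
  rw [theta1_eq_jacobiTheta₂, theta1_eq_jacobiTheta₂, add_right_comm u 1, jacobiTheta₂_add_left,
    mul_add (Real.pi * I : ℂ) u, ← add_assoc, mul_one, exp_add _ (Real.pi * I), exp_pi_mul_I]
  ring

theorem theta1_add_period (u Δ : ℂ) :
    theta1 (u + Δ) Δ = -exp (-(Real.pi * I * Δ) - 2 * Real.pi * I * u) * theta1 u Δ := by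
  rw [theta1_eq_jacobiTheta₂, theta1_eq_jacobiTheta₂, add_right_comm u Δ, jacobiTheta₂_add_left']
  have : exp (Real.pi * I * Δ / 4 + Real.pi * I * (u + Δ)) *
      exp (-Real.pi * I * (Δ + 2 * (u + (1 + Δ) / 2))) =
      -exp (-(Real.pi * I * Δ) - 2 * Real.pi * I * u) *
        exp (Real.pi * I * Δ / 4 + Real.pi * I * u) := by
    rw [neg_exp_eq, ← exp_add, ← exp_add,
      ← exp_periodic]
    ring_nf
  linear_combination -I * jacobiTheta₂ (u + (1 + Δ) / 2) Δ * this

/-- `jacobiTheta₂` is even, and the half-periods `±(1 + Δ) / 2` differ by the lattice vector `1 +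
Δ`. -/
theorem theta1_neg (u Δ : ℂ) : theta1 (-u) Δ = -theta1 u Δ := by
  have h1 : jacobiTheta₂ (-u + (1 + Δ) / 2) Δ = jacobiTheta₂ (u - (1 + Δ) / 2) Δ := by
    rw [← jacobiTheta₂_neg_left]; ring_nf
  have h2 : jacobiTheta₂ (u + (1 + Δ) / 2) Δ =
      exp (-Real.pi * I * (2 * u - 1)) * jacobiTheta₂ (u - (1 + Δ) / 2) Δ := by
    rw [show u + (1 + Δ) / 2 = u - (1 + Δ) / 2 + Δ + 1 by ring, jacobiTheta₂_add_left,
      jacobiTheta₂_add_left']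
    ring_nf
  have h3 : exp (Real.pi * I * Δ / 4 + Real.pi * I * -u) =
      -(exp (Real.pi * I * Δ / 4 + Real.pi * I * u) * exp (-Real.pi * I * (2 * u - 1))) := by
    rw [← exp_add, neg_exp_eq, ← exp_periodic]
    ring_nf
  rw [theta1_eq_jacobiTheta₂, theta1_eq_jacobiTheta₂, h1, h2, h3]
  ring

theorem theta1_zero (Δ : ℂ) : theta1 0 Δ = 0 := by
  have := theta1_neg 0 Δ
  rw [neg_zero] at this
  linear_combination this / 2

/-- The integral is the zeroth Fourier coefficient. It serves to show that the theta function is not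
identically zero. -/
theorem integral_jacobiTheta₂ {Δ : ℂ} (hΔ : 0 < Δ.im) :
    ∫ x in (0 : ℝ)..1, jacobiTheta₂ x Δ = 1 := by
  let f : ℤ → C(ℝ, ℂ) := fun n =>
    ⟨fun x : ℝ => jacobiTheta₂_term n x Δ, by unfold jacobiTheta₂_term; fun_prop⟩
  have hb : ∀ n x, ‖f n x‖ = Real.exp (-Real.pi * n ^ 2 * Δ.im) := by
    intro n x
    simp [f, norm_jacobiTheta₂_term]
  have hsum : Summable fun n : ℤ => Real.exp (-Real.pi * n ^ 2 * Δ.im) := by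
    have := ((summable_jacobiTheta₂_term_iff 0 Δ).2 hΔ).norm
    simpa [norm_jacobiTheta₂_term] using this
  have h := intervalIntegral.hasSum_intervalIntegral_of_summable_norm (a := 0) (b := 1) (f := f)
    (hsum.of_nonneg_of_le (fun _ => norm_nonneg _) fun n => by
      refine (ContinuousMap.norm_le _ (Real.exp_nonneg _)).2 fun x => ?_
      exact (hb n x).le)
  have h0 : ∀ n : ℤ, n ≠ 0 → ∫ x in (0 : ℝ)..1, f n x = 0 := by
    intro n hn
    have hc : (2 * Real.pi * I * n : ℂ) ≠ 0 := mul_ne_zero two_pi_I_ne_zero (by exact_mod_cast hn)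
    have : ∀ x : ℝ, f n x = exp (Real.pi * I * n ^ 2 * Δ) * exp (2 * Real.pi * I * n * x) := by
      intro x
      simp only [f, ContinuousMap.coe_mk, jacobiTheta₂_term, ← exp_add]
      ring_nf
    simp only [this]
    rw [intervalIntegral.integral_const_mul, integral_exp_mul_complex hc]
    have : exp (2 * Real.pi * I * n * (1 : ℝ)) = 1 := by
      rw [exp_eq_one_iff]; exact ⟨n, by push_cast; ring⟩
    rw [this]; simp
  have h1 := hasSum_single (f := fun n => ∫ x in (0 : ℝ)..1, f n x) 0 h0
  have h2 := h.unique h1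
  have h3 : ∫ x in (0 : ℝ)..1, f 0 x = 1 := by simp [f, jacobiTheta₂_term]
  rw [h3] at h2
  exact h2

theorem exists_theta1_ne_zero {Δ : ℂ} (hΔ : 0 < Δ.im) : ∃ u, theta1 u Δ ≠ 0 := by
  by_contra! h
  have h0 : ∀ z, jacobiTheta₂ z Δ = 0 := by
    intro z
    have := h (z - (1 + Δ) / 2)
    rw [theta1_eq_jacobiTheta₂, sub_add_cancel] at this
    simpa [exp_ne_zero] using this
  have := integral_jacobiTheta₂ hΔ
  simp [h0] at this

theorem theta1_lattice_eq_zero (Δ : ℂ) (m n : ℤ) : theta1 (m + n * Δ) Δ = 0 := by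
  have := apply_add_lattice (H := fun z => (theta1 z Δ = 0)) (Δ := Δ)
    (fun z => by simp [theta1_add_one]) (fun z => by simp [theta1_add_period, exp_ne_zero]) 0 m n
  rw [zero_add] at this
  exact this.mpr (theta1_zero Δ)

/-- Both functions have the same multipliers, and `theta1` vanishes at every zero of the product.
The value of the constant in the triple product formula is not needed, only that it is nonzero. -/
theorem exists_theta1_eq_mul_thetaProd {Δ : ℂ} (hΔ : 0 < Δ.im) :
    ∃ c, c ≠ 0 ∧ ∀ u, theta1 u Δ = c * thetaProd Δ u := by
  obtain ⟨c, hc⟩ := exists_eq_mul_of_quasiPeriodic hΔ (differentiable_theta1 hΔ)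
    (differentiable_thetaProd hΔ) (e₁ := fun _ => -1)
    (e₂ := fun z => -exp (-(Real.pi * I * Δ) - 2 * Real.pi * I * z)) (by simp)
    (by simp [exp_ne_zero]) (theta1_add_one · Δ) (thetaProd_add_one Δ) (theta1_add_period · Δ)
    (thetaProd_add_period hΔ)
    (fun z hz => by
      obtain ⟨m, n, rfl⟩ := exists_of_thetaProd_eq_zero hΔ hz
      exact theta1_lattice_eq_zero Δ m n)
    (fun z => deriv_thetaProd_ne_zero hΔ)
  refine ⟨c, ?_, hc⟩
  rintro rfl
  obtain ⟨u, hu⟩ := exists_theta1_ne_zero hΔ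
  exact hu (by rw [hc, zero_mul])

theorem theta1_eq_zero_iff {Δ : ℂ} (hΔ : 0 < Δ.im) {u : ℂ} :
    theta1 u Δ = 0 ↔ ∃ m n : ℤ, u = m + n * Δ := by
  refine ⟨fun h => ?_, ?_⟩
  · obtain ⟨c, hc, h'⟩ := exists_theta1_eq_mul_thetaProd hΔ
    rw [h', mul_eq_zero, or_iff_right hc] at h
    exact exists_of_thetaProd_eq_zero hΔ h
  · rintro ⟨m, n, rfl⟩
    exact theta1_lattice_eq_zero Δ m n

theorem theta1'_ne_zero {Δ u : ℂ} (hΔ : 0 < Δ.im) (h : theta1 u Δ = 0) : theta1' u Δ ≠ 0 := by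
  obtain ⟨c, hc, h'⟩ := exists_theta1_eq_mul_thetaProd hΔ
  have h2 : thetaProd Δ u = 0 := by
    rw [h', mul_eq_zero, or_iff_right hc] at h
    exact h
  unfold theta1'
  rw [show (fun s => theta1 s Δ) = fun s => c * thetaProd Δ s from funext h',
    deriv_const_mul _ (differentiable_thetaProd hΔ u)]
  exact mul_ne_zero hc (deriv_thetaProd_ne_zero hΔ h2)

theorem hasDerivAt_theta1 {Δ : ℂ} (hΔ : 0 < Δ.im) (u : ℂ) :
    HasDerivAt (fun s => theta1 s Δ) (theta1' u Δ) u :=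
  (differentiable_theta1 hΔ u).hasDerivAt

theorem theta1'_neg (u Δ : ℂ) : theta1' (-u) Δ = theta1' u Δ := by
  have h := deriv_comp_neg (fun s => theta1 s Δ) u
  simp only [theta1_neg, deriv.fun_neg] at h
  unfold theta1'
  linear_combination h

/-! ### The bilinear identity -/

theorem differentiable_theta1' {Δ : ℂ} (hΔ : 0 < Δ.im) :
    Differentiable ℂ (fun u => theta1' u Δ) := fun u =>
  ((differentiable_theta1 hΔ).analyticAt u).deriv.differentiableAt

theorem theta1'_add_one (u Δ : ℂ) : theta1' (u + 1) Δ = -1 * theta1' u Δ := by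
  unfold theta1'
  rw [← deriv_comp_add_const]
  simp [theta1_add_one]

theorem theta1'_add_period {Δ : ℂ} (hΔ : 0 < Δ.im) (u : ℂ) :
    theta1' (u + Δ) Δ = -exp (-(Real.pi * I * Δ) - 2 * Real.pi * I * u) *
      (theta1' u Δ - 2 * Real.pi * I * theta1 u Δ) := by
  have h1 : HasDerivAt (fun s : ℂ => -exp (-(Real.pi * I * Δ) - 2 * Real.pi * I * s))
      (2 * Real.pi * I * exp (-(Real.pi * I * Δ) - 2 * Real.pi * I * u)) u := by
    have := ((((hasDerivAt_id u).const_mul (2 * Real.pi * I)).const_sub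
      (-(Real.pi * I * Δ))).cexp).neg
    simp only [id, mul_one] at this
    refine this.congr_deriv ?_
    ring
  have h2 := h1.mul (hasDerivAt_theta1 hΔ u)
  have h3 : theta1' (u + Δ) Δ = deriv (fun s => theta1 (s + Δ) Δ) u :=
    (deriv_comp_add_const (fun s => theta1 s Δ) Δ u).symm
  rw [h3, show (fun s => theta1 (s + Δ) Δ) = _ from funext fun s => theta1_add_period s Δ]
  simp only [Pi.mul_def] at h2
  rw [h2.deriv]
  ring

/-- The addition formula for `ϑ₁` behind the bilinear equation. -/
theorem theta1_bilinear {Δ a b : ℂ} (hΔ : 0 < Δ.im) (ha : theta1 a Δ ≠ 0) (hb : theta1 b Δ ≠ 0)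
    (hab : theta1 (a - b) Δ ≠ 0) (u : ℂ) :
    -(theta1 b Δ * theta1 (a - b) Δ / (theta1' 0 Δ * theta1 a Δ)) *
      (theta1' (u + a) Δ * theta1 u Δ - theta1 (u + a) Δ * theta1' u Δ) =
    theta1 (u + a - b) Δ * theta1 (u + b) Δ -
      -(theta1 b Δ * theta1 (a - b) Δ / (theta1' 0 Δ * theta1 a Δ)) *
        (theta1' (b - a) Δ / theta1 (b - a) Δ - theta1' b Δ / theta1 b Δ) *
          (theta1 (u + a) Δ * theta1 u Δ) := by
  have h0 : theta1' 0 Δ ≠ 0 := theta1'_ne_zero hΔ (theta1_zero Δ)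
  -- This value makes `G` below vanish at `0` and `-a`, hence at all zeros of `g`; the value of `K`
  -- makes it vanish at `-b`.
  set W := -(theta1 b Δ * theta1 (a - b) Δ / (theta1' 0 Δ * theta1 a Δ)) with hW
  have hWr : W * (theta1' 0 Δ * theta1 a Δ) = -(theta1 b Δ * theta1 (a - b) Δ) := by
    rw [hW]; field_simp
  have hba : theta1 (b - a) Δ = -theta1 (a - b) Δ := by rw [← theta1_neg, neg_sub]
  have hba' : theta1' (b - a) Δ = theta1' (a - b) Δ := by rw [← theta1'_neg, neg_sub]
  set K := W * (theta1' (b - a) Δ / theta1 (b - a) Δ - theta1' b Δ / theta1 b Δ) with hK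
  set G : ℂ → ℂ := fun u => W * (theta1' (u + a) Δ * theta1 u Δ - theta1 (u + a) Δ * theta1' u Δ)
    + K * (theta1 (u + a) Δ * theta1 u Δ) - theta1 (u + a - b) Δ * theta1 (u + b) Δ with hG
  set g : ℂ → ℂ := fun u => theta1 (u + a) Δ * theta1 u Δ with hg
  have hd := differentiable_theta1 hΔ
  have hd' := differentiable_theta1' hΔ
  have hGd : Differentiable ℂ G := by
    have h1 := fun c => hd.comp (differentiable_id.add_const c)
    have h2 := fun c => hd'.comp (differentiable_id.add_const c)
    have h3 := h1 a
    have h4 := h1 b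
    have h5 := h1 (a - b)
    have h6 := h2 a
    simp only [Function.comp_def, id] at h3 h4 h5 h6
    simp only [hG, add_sub_assoc]
    fun_prop
  have hgd : Differentiable ℂ g := by
    have h3 := hd.comp (differentiable_id.add_const a)
    simp only [Function.comp_def, id] at h3
    fun_prop
  have e1 : ∀ c, theta1 (u + 1 + c) Δ = -1 * theta1 (u + c) Δ := fun c => by
    rw [← theta1_add_one]; ring_nf
  set e : ℂ → ℂ := fun z => -exp (-(Real.pi * I * Δ) - 2 * Real.pi * I * z) with he
  have hmul : ∀ z, e (z + (a - b)) * e (z + b) = e (z + a) * e z := by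
    intro z
    simp only [he, neg_mul_neg, ← exp_add]
    ring_nf
  have hθ : ∀ z, theta1 (z + Δ) Δ = e z * theta1 z Δ := fun z => theta1_add_period z Δ
  have hθ' : ∀ z, theta1' (z + Δ) Δ = e z * (theta1' z Δ - 2 * Real.pi * I * theta1 z Δ) :=
    fun z => theta1'_add_period hΔ z
  have hG1 : ∀ z, G (z + 1) = 1 * G z := by
    intro z
    simp only [hG, add_sub_assoc, add_right_comm z 1, theta1_add_one, theta1'_add_one]
    ring
  have hg1 : ∀ z, g (z + 1) = 1 * g z := by
    intro z
    simp only [hg, add_right_comm z 1, theta1_add_one]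
    ring
  -- The terms `-2πi ϑ₁` produced by shifting the two derivatives cancel in the antisymmetric
  -- combination.
  have hG2 : ∀ z, G (z + Δ) = (e (z + a) * e z) * G z := by
    intro z
    simp only [hG, add_sub_assoc, add_right_comm z Δ, hθ, hθ']
    linear_combination -theta1 (z + (a - b)) Δ * theta1 (z + b) Δ * hmul z
  have hg2 : ∀ z, g (z + Δ) = (e (z + a) * e z) * g z := by
    intro z
    simp only [hg, add_right_comm z Δ, hθ]
    ring
  have he0 : ∀ z, e z ≠ 0 := fun z => neg_ne_zero.2 (exp_ne_zero _)
  have hee : ∀ z, e (z + a) * e z ≠ 0 := fun z => mul_ne_zero (he0 _) (he0 _)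
  have hGlat : ∀ z (m n : ℤ), (G (z + (m + n * Δ)) = 0) = (G z = 0) :=
    apply_add_lattice (H := fun z => (G z = 0)) (fun z => by simp [hG1])
      (fun z => by simp [hG2, hee])
  have hθlat : ∀ z (m n : ℤ), (theta1 (z + (m + n * Δ)) Δ = 0) = (theta1 z Δ = 0) :=
    apply_add_lattice (H := fun z => (theta1 z Δ = 0)) (fun z => by simp [theta1_add_one])
      (fun z => by simp [hθ, he0])
  -- The two factors of `g` cannot vanish together, since `a` is not a lattice point; hence the
  -- zeros of `g` are simple.
  have hsplit : ∀ z, g z = 0 → (theta1 z Δ = 0 ∧ theta1 (z + a) Δ ≠ 0) ∨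
      (theta1 (z + a) Δ = 0 ∧ theta1 z Δ ≠ 0) := by
    intro z hz
    have : ¬ (theta1 z Δ = 0 ∧ theta1 (z + a) Δ = 0) := by
      rintro ⟨h1, h2⟩
      obtain ⟨m, n, rfl⟩ := (theta1_eq_zero_iff hΔ).1 h1
      rw [add_comm, hθlat] at h2
      exact ha h2
    rcases mul_eq_zero.1 hz with h | h <;> tauto
  obtain ⟨c, hc⟩ := exists_eq_mul_of_quasiPeriodic hΔ hGd hgd (by simp) hee hG1 hg1 hG2 hg2
    (fun z hz => by
      rcases hsplit z hz with ⟨h, -⟩ | ⟨h, -⟩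
      · obtain ⟨m, n, rfl⟩ := (theta1_eq_zero_iff hΔ).1 h
        rw [← zero_add ((m : ℂ) + n * Δ), hGlat]
        simp only [hG, zero_add, theta1_zero]
        linear_combination -hWr
      · obtain ⟨m, n, hmn⟩ := (theta1_eq_zero_iff hΔ).1 h
        rw [show z = -a + (m + n * Δ) by rw [← hmn]; ring, hGlat]
        simp only [hG, neg_add_cancel, theta1_zero, theta1_neg, zero_sub,
          show -a + b = -(a - b) by ring]
        linear_combination -hWr)
    (fun z hz => by
      have h1 := ((hasDerivAt_theta1 hΔ (z + a)).comp_add_const z a).mul (hasDerivAt_theta1 hΔ z)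
      simp only [Pi.mul_def] at h1
      rw [h1.deriv]
      rcases hsplit z hz with ⟨h, h'⟩ | ⟨h, h'⟩
      · rw [h, mul_zero, zero_add]
        exact mul_ne_zero h' (theta1'_ne_zero hΔ h)
      · rw [h, zero_mul, add_zero]
        exact mul_ne_zero (theta1'_ne_zero hΔ h) h')
  have hc0 : c = 0 := by
    have h1 := hc (-b)
    have h2 : G (-b) = 0 := by
      simp only [hG, neg_add_cancel, theta1_zero, theta1_neg, theta1'_neg,
        show -b + a = a - b by ring, hK, hba, hba']
      field_simp
      ring
    rw [h2] at h1
    have h3 : g (-b) ≠ 0 := by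
      simp only [hg, theta1_neg, show -b + a = a - b by ring]
      exact mul_ne_zero hab (neg_ne_zero.2 hb)
    exact (mul_eq_zero.1 h1.symm).resolve_right h3
  have := hc u
  rw [hc0, zero_mul] at this
  simp only [hG] at this
  linear_combination this

section

variable {γ δ ε Δ : ℂ} {k : ℤ}

theorem hasDerivAt_tau (hΔ : 0 < Δ.im) (x t : ℂ) :
    HasDerivAt (tau γ δ ε Δ k x)
      (omega γ δ ε Δ k * theta1' (k * x + omega γ δ ε Δ k * t) Δ) t := by
  have h1 : HasDerivAt (fun t : ℂ => (k : ℂ) * x + omega γ δ ε Δ k * t) (omega γ δ ε Δ k) t := by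
    simpa using ((hasDerivAt_id t).const_mul (omega γ δ ε Δ k)).const_add ((k : ℂ) * x)
  have h2 := HasDerivAt.comp t (hasDerivAt_theta1 hΔ (k * x + omega γ δ ε Δ k * t)) h1
  exact h2.congr_deriv (mul_comm _ _)

theorem differentiable_tau (hΔ : 0 < Δ.im) (t : ℂ) :
    Differentiable ℂ fun z => tau γ δ ε Δ k z t := by
  have h := differentiable_theta1 hΔ
  have := h.comp (f := fun z : ℂ => (k : ℂ) * z + omega γ δ ε Δ k * t) (by fun_prop)
  exact this

theorem theta1_ne_zero (hΔ : 0 < Δ.im) {u : ℂ} (h : ∀ m n : ℤ, u ≠ m + n * Δ) :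
    theta1 u Δ ≠ 0 := by
  rw [Ne, theta1_eq_zero_iff hΔ]
  simpa using h

theorem tau_bilinear (hΔ : 0 < Δ.im) (hkγ : theta1 (k * γ) Δ ≠ 0) (hkδ : theta1 (k * δ) Δ ≠ 0)
    (hkδγ : theta1 (k * (δ - γ)) Δ ≠ 0) :
    IsBilinearSolution γ δ ε (etaZero γ δ ε Δ k) (tau γ δ ε Δ k) := by
  refine ⟨fun x t => (hasDerivAt_tau hΔ x t).differentiableAt, fun x t => ?_⟩
  rw [hirotaD, (hasDerivAt_tau hΔ _ _).deriv, (hasDerivAt_tau hΔ _ _).deriv]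
  simp only [tau, etaZero]
  rw [mul_sub] at hkδγ
  have h := theta1_bilinear hΔ hkδ hkγ hkδγ (k * x + omega γ δ ε Δ k * t)
  rw [show (k : ℂ) * (x + δ) + omega γ δ ε Δ k * t = k * x + omega γ δ ε Δ k * t + k * δ by ring,
    show (k : ℂ) * (x + δ - γ) + omega γ δ ε Δ k * t =
      k * x + omega γ δ ε Δ k * t + k * δ - k * γ by ring,
    show (k : ℂ) * (x + γ) + omega γ δ ε Δ k * t = k * x + omega γ δ ε Δ k * t + k * γ by ring,
    mul_sub (k : ℂ) γ δ]
  generalize (k : ℂ) * x + omega γ δ ε Δ k * t = u at *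
  rw [omega, mul_sub]
  linear_combination ε * h

/-! ### The elliptic solution as a function of `z` -/

/-- The shifts in the numerator and in the denominator have the same sum, `(δ - γ) + γ = δ + 0`, so
the multipliers cancel. Moving `z` by `Δ / k` moves the theta argument by `Δ`. -/
theorem eta_periodic (hk : k ≠ 0) (t : ℂ) :
    Function.Periodic (fun z => eta γ δ ε Δ k z t) 1 ∧
      Function.Periodic (fun z => eta γ δ ε Δ k z t) (Δ / k) := by
  set E : ℂ → ℂ := fun u => theta1 (u + (k * δ - k * γ)) Δ * theta1 (u + k * γ) Δ /
    (theta1 (u + k * δ) Δ * theta1 u Δ) with hE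
  have hk' : (k : ℂ) ≠ 0 := by exact_mod_cast hk
  have hη : ∀ z, eta γ δ ε Δ k z t = ε * E (k * z + omega γ δ ε Δ k * t) := by
    intro z
    simp only [eta, tau, hE]
    rw [show (k : ℂ) * (z + δ) + omega γ δ ε Δ k * t = k * z + omega γ δ ε Δ k * t + k * δ by ring,
      show (k : ℂ) * (z + δ - γ) + omega γ δ ε Δ k * t =
        k * z + omega γ δ ε Δ k * t + (k * δ - k * γ) by ring,
      show (k : ℂ) * (z + γ) + omega γ δ ε Δ k * t = k * z + omega γ δ ε Δ k * t + k * γ by ring]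
  have h1 : Function.Periodic E 1 := by
    intro z
    simp only [hE, add_right_comm z 1, theta1_add_one]
    simp
  have h2 : Function.Periodic E Δ := by
    intro z
    simp only [hE, add_right_comm z Δ, theta1_add_period]
    set e : ℂ → ℂ := fun z => -exp (-(Real.pi * I * Δ) - 2 * Real.pi * I * z) with he
    have hmul : e (z + (k * δ - k * γ)) * e (z + k * γ) = e (z + k * δ) * e z := by
      simp only [he, neg_mul_neg, ← exp_add]
      ring_nf
    have h0 : e (z + k * δ) * e z ≠ 0 := by simp [he, exp_ne_zero]
    change e (z + (k * δ - k * γ)) * _ * (e (z + k * γ) * _) /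
      (e (z + k * δ) * _ * (e z * _)) = _
    rw [mul_mul_mul_comm, mul_mul_mul_comm (e (z + k * δ)), hmul, mul_div_mul_left _ _ h0]
  refine ⟨fun z => ?_, fun z => ?_⟩
  · simp only [hη]
    have := h1.int_mul k (k * z + omega γ δ ε Δ k * t)
    rw [← this]
    ring_nf
  · simp only [hη]
    rw [← h2 (k * z + omega γ δ ε Δ k * t)]
    congr 2
    field_simp
    ring

theorem eta_meromorphic (hΔ : 0 < Δ.im) (t : ℂ) : Meromorphic fun z => eta γ δ ε Δ k z t := by
  intro z
  have h := differentiable_tau (γ := γ) (δ := δ) (ε := ε) (k := k) hΔ t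
  have h1 : ∀ c, MeromorphicAt (fun z => tau γ δ ε Δ k (z + c) t) z := fun c =>
    (((h.comp (differentiable_id.add_const c)).analyticAt z)).meromorphicAt
  have h3 := h1 δ
  have h4 := h1 γ
  have h5 := h1 (δ - γ)
  have h6 := h1 0
  simp only [add_zero] at h6
  unfold eta
  simp only [add_sub_assoc]
  exact (MeromorphicAt.const ε z).fun_mul ((h5.fun_mul h4).fun_div (h3.fun_mul h6))

/-! ### The regular times -/

theorem tau_add_int_eq_zero_iff (z t : ℂ) (n : ℤ) :
    tau γ δ ε Δ k (z + n) t = 0 ↔ tau γ δ ε Δ k z t = 0 := by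
  have := Function.Periodic.int_mul (f := fun u => (theta1 u Δ = 0)) (c := 1)
    (fun u => by simp [theta1_add_one]) (k * n) (k * z + omega γ δ ε Δ k * t)
  rw [mul_one, Int.cast_mul] at this
  simp only [tau]
  rw [mul_add, add_right_comm]
  exact Iff.of_eq this

/-- Zeros of `τ` are invariant under integer translation, so the noncompact strip may be replaced by
a compact rectangle of width one. -/
theorem isOpen_regularTimes (hΔ : 0 < Δ.im) : IsOpen (regularTimes δ (tau γ δ ε Δ k)) := by
  rw [isOpen_iff_mem_nhds]
  intro t₀ ht₀
  have hK : IsCompact (Set.Icc (0 : ℝ) 1 ×ℂ Set.Icc (0 : ℝ) δ.im) :=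
    isCompact_Icc.reProdIm isCompact_Icc
  have hcont : Continuous fun p : ℂ × ℂ => tau γ δ ε Δ k p.2 p.1 := by
    have := (differentiable_theta1 hΔ).continuous
    unfold tau
    fun_prop
  have := hK.eventually_forall_of_forall_eventually (x₀ := t₀)
    (P := fun t z => tau γ δ ε Δ k z t ≠ 0) (fun z hz => by
      obtain ⟨-, h1, h2⟩ := hz
      exact hcont.continuousAt.eventually_ne (ht₀ z h1 h2))
  filter_upwards [this] with t ht z h1 h2 h0
  have h3 := (tau_add_int_eq_zero_iff (γ := γ) (δ := δ) (ε := ε) (Δ := Δ) (k := k) z t (-⌊z.re⌋)).2 h0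
  refine ht (z + ((-⌊z.re⌋ : ℤ) : ℂ)) ⟨⟨?_, ?_⟩, ?_⟩ h3
  · simp [Int.floor_le]
  · simp only [add_re, intCast_re]
    push_cast
    linarith [Int.lt_floor_add_one z.re]
  · simp [h1, h2]

theorem regularTimes_nonempty (hΔ : 0 < Δ.im) (hω : omega γ δ ε Δ k ≠ 0)
    (h : |(k : ℝ)| * δ.im < Δ.im) : (regularTimes δ (tau γ δ ε Δ k)).Nonempty := by
  -- With `ω(k) t = s * I` the middle line of the strip is mapped to height `Im Δ / 2`, halfway
  -- between two rows of zeros.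
  set s : ℝ := (Δ.im - k * δ.im) / 2 with hs
  refine ⟨s * I / omega γ δ ε Δ k, fun z h1 h2 h0 => ?_⟩
  rw [tau, mul_div_cancel₀ _ hω, theta1_eq_zero_iff hΔ] at h0
  obtain ⟨m, n, hmn⟩ := h0
  have him := congrArg Complex.im hmn
  simp at him
  have hlt : |(k : ℝ) * z.im - k * δ.im / 2| < Δ.im / 2 := by
    rw [show (k : ℝ) * z.im - k * δ.im / 2 = k * (z.im - δ.im / 2) by ring, abs_mul]
    have : |z.im - δ.im / 2| ≤ δ.im / 2 := abs_le.2 ⟨by linarith, by linarith⟩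
    nlinarith [mul_le_mul_of_nonneg_left this (abs_nonneg (k : ℝ))]
  obtain ⟨h3, h4⟩ := abs_lt.1 hlt
  have h5 : 0 < (n : ℝ) * Δ.im := by rw [← him]; linarith
  have h6 : (n : ℝ) * Δ.im < 1 * Δ.im := by rw [← him]; linarith
  have h7 : (0 : ℝ) < n := pos_of_mul_pos_left h5 hΔ.le
  have h8 : (n : ℝ) < 1 := lt_of_mul_lt_mul_right h6 hΔ.le
  have h9 : 0 < n := by exact_mod_cast h7
  have h10 : n < 1 := by exact_mod_cast h8
  omega

end

/-! ### The Weierstrass zeta function of a period pair -/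

section zeta

variable (L : PeriodPair)

/-- The Weierstrass zeta function without its term `1 / z`. -/
noncomputable def zetaExcept (z : ℂ) : ℂ :=
  ∑' l : L.lattice, if l.1 = 0 then 0 else (1 / (z - l.1) + 1 / l.1 + z / l.1 ^ 2)

/-- The term equals `z² / ((z - l) l²)`, and `‖z - l‖ ≥ ‖l‖ / 2`. The exponent `-3` is summable over
a lattice of rank two. -/
theorem norm_zeta_term_le {r : ℝ} {z l : ℂ} (hr : 0 < r) (hz : ‖z‖ < r) (h : 2 * r ≤ ‖l‖) :
    ‖1 / (z - l) + 1 / l + z / l ^ 2‖ ≤ 2 * r ^ 2 * ‖l‖ ^ (-3 : ℝ) := by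
  have hl : 0 < ‖l‖ := by linarith
  have hl0 : l ≠ 0 := norm_pos_iff.1 hl
  have h1 : ‖l‖ / 2 ≤ ‖z - l‖ := by
    rw [norm_sub_rev]
    exact le_trans (by linarith) (norm_sub_norm_le l z)
  have hzl : z - l ≠ 0 := norm_pos_iff.1 (by linarith)
  have h2 : 1 / (z - l) + 1 / l + z / l ^ 2 = z ^ 2 / ((z - l) * l ^ 2) := by
    field_simp
    ring
  have h3 : ‖l‖ ^ (-3 : ℝ) = 1 / ‖l‖ ^ 3 := by
    rw [Real.rpow_neg hl.le, one_div]; norm_cast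
  rw [h2, norm_div, norm_mul, norm_pow, norm_pow, h3]
  calc ‖z‖ ^ 2 / (‖z - l‖ * ‖l‖ ^ 2) ≤ r ^ 2 / (‖l‖ / 2 * ‖l‖ ^ 2) := by gcongr
    _ = 2 * r ^ 2 * (1 / ‖l‖ ^ 3) := by field_simp

theorem hasSumLocallyUniformly_zetaExcept : HasSumLocallyUniformly
    (fun (l : L.lattice) (z : ℂ) => if l.1 = 0 then 0 else (1 / (z - l.1) + 1 / l.1 + z / l.1 ^ 2))
    (zetaExcept L) := by
  refine L.hasSumLocallyUniformly_aux (u := fun r l => 2 * r ^ 2 * ‖l‖ ^ (-3 : ℝ)) _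
    (fun _ _ => (ZLattice.summable_norm_rpow _ _ (by simp; norm_num)).mul_left _) fun r hr =>
    Filter.eventually_atTop.mpr ⟨2 * r, ?_⟩
  rintro _ h s hs l rfl
  split_ifs
  · rw [norm_zero]; positivity
  · exact norm_zeta_term_le hr hs h

theorem hasDerivAt_zeta_term {l z : ℂ} (h : z - l ≠ 0) :
    HasDerivAt (fun z => 1 / (z - l) + 1 / l + z / l ^ 2) (-(1 / (z - l) ^ 2 - 1 / l ^ 2)) z := by
  have h1 := ((((hasDerivAt_id z).sub_const l).inv h).add_const (1 / l)).add
    ((hasDerivAt_id z).div_const (l ^ 2))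
  simp only [id, Pi.add_def, ← one_div] at h1
  refine (h1.congr_deriv ?_)
  ring

theorem hasDerivAt_zetaExcept {z : ℂ} (hz : z ∈ ((L.lattice : Set ℂ) \ {0})ᶜ) :
    HasDerivAt (zetaExcept L) (-L.weierstrassPExcept 0 z) z := by
  have hterm : ∀ (l : L.lattice) (z : ℂ), z ∈ ((L.lattice : Set ℂ) \ {0})ᶜ →
      HasDerivAt (fun z : ℂ => if l.1 = 0 then 0 else (1 / (z - l.1) + 1 / l.1 + z / l.1 ^ 2))
        (-(if l.1 = 0 then 0 else (1 / (z - l.1) ^ 2 - 1 / l.1 ^ 2))) z := by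
    intro l z hz
    split_ifs with hl
    · simpa using hasDerivAt_const z (0 : ℂ)
    · refine hasDerivAt_zeta_term fun h => hz ?_
      rw [sub_eq_zero.1 h]
      exact ⟨l.2, hl⟩
  have hd := (hasSumLocallyUniformly_zetaExcept L).hasSumLocallyUniformlyOn.differentiableOn
    (.of_forall fun s => .fun_sum fun i _ z hz =>
      (hterm i z hz).differentiableAt.differentiableWithinAt) L.isOpen_compl_lattice_sdiff
  have h1 := (hd.differentiableAt (L.isOpen_compl_lattice_sdiff.mem_nhds hz)).hasDerivAt
  refine h1.congr_deriv ?_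
  have h2 := (((hasSumLocallyUniformly_zetaExcept L).tendstoLocallyUniformlyOn.deriv
    (.of_forall fun s => .fun_sum fun i _ z hz =>
      (hterm i z hz).differentiableAt.differentiableWithinAt)
    L.isOpen_compl_lattice_sdiff).tendsto_at hz)
  refine tendsto_nhds_unique h2 ?_
  have h3 := (L.hasSum_weierstrassPExcept 0 z).neg
  refine Tendsto.congr (fun s => ?_) h3
  simp only [Function.comp_apply]
  exact (HasDerivAt.fun_sum fun i _ => hterm i z hz).deriv.symm

theorem zetaExcept_neg (z : ℂ) : zetaExcept L (-z) = -zetaExcept L z := by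
  unfold zetaExcept
  rw [← (Equiv.neg L.lattice).tsum_eq, ← tsum_neg]
  refine tsum_congr fun l => ?_
  simp only [Equiv.neg_apply, Submodule.coe_neg, neg_eq_zero]
  split_ifs
  · simp
  · rw [show -z - -l.1 = -(z - l.1) by ring]
    simp only [div_neg, neg_div, even_two, Even.neg_pow]
    ring

/-- The Weierstrass zeta function of a period pair. -/
noncomputable def latticeZeta (z : ℂ) : ℂ := 1 / z + zetaExcept L z

theorem latticeZeta_neg (z : ℂ) : latticeZeta L (-z) = -latticeZeta L z := by
  rw [latticeZeta, latticeZeta, zetaExcept_neg, div_neg]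
  ring

theorem hasDerivAt_latticeZeta {z : ℂ} (hz : z ∉ L.lattice) :
    HasDerivAt (latticeZeta L) (-L.weierstrassP z) z := by
  have hz0 : z ≠ 0 := fun h => hz (h ▸ L.lattice.zero_mem)
  have h1 := ((hasDerivAt_id z).inv hz0).add (hasDerivAt_zetaExcept L (z := z) fun h => hz h.1)
  have h2 := L.weierstrassPExcept_add 0 z
  simp only [id, Pi.add_def, ← one_div] at h1
  refine h1.congr_deriv ?_
  simp only [ZeroMemClass.coe_zero, sub_zero] at h2
  rw [← h2]
  simp
  ring

theorem isPreconnected_compl_lattice : IsPreconnected (L.lattice : Set ℂ)ᶜ := by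
  refine (Set.Countable.isPathConnected_compl_of_one_lt_rank ?_ ?_).isConnected.isPreconnected
  · rw [rank_real_complex]; norm_num
  · have : Countable L.lattice := L.latticeEquivProd.toEquiv.countable_iff.2 inferInstance
    exact Set.countable_coe_iff.1 this

/-- The derivative `-℘` is periodic, and the plane minus a countable set is connected, so the
difference is constant. -/
theorem latticeZeta_add (l : L.lattice) :
    ∃ c, ∀ z, z ∉ L.lattice → latticeZeta L (z + l) = latticeZeta L z + c := by
  have hmem : ∀ z : ℂ, z ∉ L.lattice → z + l.1 ∉ L.lattice := fun z hz h =>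
    hz (by simpa using L.lattice.sub_mem h l.2)
  have hd : ∀ z ∈ (L.lattice : Set ℂ)ᶜ,
      HasDerivAt (fun z => latticeZeta L (z + l.1) - latticeZeta L z) 0 z := by
    intro z hz
    have h1 := ((hasDerivAt_latticeZeta L (hmem z hz)).comp_add_const z l.1).sub
      (hasDerivAt_latticeZeta L hz)
    rw [L.weierstrassP_add_coe, sub_self] at h1
    exact h1
  obtain ⟨c, hc⟩ := L.isClosed_lattice.isOpen_compl.exists_is_const_of_deriv_eq_zero
    (isPreconnected_compl_lattice L)
    (fun z hz => (hd z hz).differentiableAt.differentiableWithinAt) (fun z hz => (hd z hz).deriv)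
  exact ⟨c, fun z hz => by linear_combination hc z hz⟩

theorem analyticAt_latticeZeta {z : ℂ} (hz : z ∉ L.lattice) : AnalyticAt ℂ (latticeZeta L) z := by
  refine Complex.analyticAt_iff_eventually_differentiableAt.2 ?_
  filter_upwards [L.isClosed_lattice.isOpen_compl.mem_nhds hz] with w hw
  exact (hasDerivAt_latticeZeta L hw).differentiableAt

/-- The pole at `0` is visible in the definition; additive quasi-periodicity transports it to the
other lattice points. -/
theorem latticeZeta_simplePole {l : ℂ} (hl : l ∈ L.lattice) :
    HasSimplePole (latticeZeta L) l 1 := by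
  have h0 : HasSimplePole (latticeZeta L) 0 1 := by
    refine ⟨zetaExcept L, ?_, by simp [latticeZeta]⟩
    refine Complex.analyticAt_iff_eventually_differentiableAt.2 ?_
    filter_upwards [L.compl_lattice_sdiff_singleton_mem_nhds 0] with w hw
    exact (hasDerivAt_zetaExcept L hw).differentiableAt
  obtain ⟨c, hc⟩ := latticeZeta_add L ⟨l, hl⟩
  have h1 : HasSimplePole (fun z => latticeZeta L (z + -l)) l 1 :=
    HasSimplePole.comp_add (by simpa using h0)
  have h2 := h1.add (HasSimplePole.of_analyticAt (f := fun _ => c) analyticAt_const)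
  rw [add_zero] at h2
  refine h2.congr ?_
  have h3 := nhdsWithin_le_nhds (L.compl_lattice_sdiff_singleton_mem_nhds l) (s := {l}ᶜ)
  filter_upwards [h3, self_mem_nhdsWithin] with z hz hz'
  have hz2 : z ∉ L.lattice := fun h => hz ⟨h, hz'⟩
  have := hc (z + -l) fun h => hz2 (by simpa using L.lattice.add_mem h hl)
  simpa using this

end zeta

/-! ### The kernel -/

/-- The period pair `(2ω₁, 2ω₂)`. -/
noncomputable def doublePeriods (ω₁ ω₂ : ℂ) (h : 0 < (ω₂ / ω₁).im) : PeriodPair where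
  ω₁ := 2 * ω₁
  ω₂ := 2 * ω₂
  indep := by
    have h0 : ω₁ ≠ 0 := by rintro rfl; simp at h
    rw [LinearIndependent.pair_iff]
    intro s t hst
    have h1 : (s : ℂ) + t * (ω₂ / ω₁) = 0 := by
      rw [real_smul, real_smul] at hst
      field_simp
      linear_combination hst / 2
    have h2 : t = 0 := by
      have := congrArg Complex.im h1
      simp only [add_im, ofReal_im, im_ofReal_mul, zero_im, zero_add] at this
      exact (mul_eq_zero.1 this).resolve_right h.ne'
    subst h2
    refine ⟨?_, rfl⟩
    simpa using h1

theorem weierstrassZeta_eq {ω₁ ω₂ : ℂ} (h : 0 < (ω₂ / ω₁).im) (z : ℂ) :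
    weierstrassZeta ω₁ ω₂ z = latticeZeta (doublePeriods ω₁ ω₂ h) z := by
  unfold weierstrassZeta latticeZeta zetaExcept
  congr 1
  set L := doublePeriods ω₁ ω₂ h with hL
  rw [← L.latticeEquivProd.symm.toEquiv.tsum_eq]
  have := tsum_subtype {v : ℤ × ℤ | v ≠ 0} fun v =>
    (1 / (z - (2 * v.1 * ω₁ + 2 * v.2 * ω₂)) + 1 / (2 * v.1 * ω₁ + 2 * v.2 * ω₂)
      + z / (2 * v.1 * ω₁ + 2 * v.2 * ω₂) ^ 2)
  refine this.trans (tsum_congr fun v => ?_)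
  have h1 : ((L.latticeEquivProd.symm v : L.lattice) : ℂ) = 2 * v.1 * ω₁ + 2 * v.2 * ω₂ := by
    rw [L.latticeEquiv_symm_apply]
    simp only [hL, doublePeriods]
    ring
  have h2 : ((L.latticeEquivProd.symm v : L.lattice) : ℂ) = 0 ↔ v = 0 := by
    rw [ZeroMemClass.coe_eq_zero, LinearEquiv.map_eq_zero_iff]
  simp only [LinearEquiv.coe_toEquiv, if_congr h2 rfl rfl, Set.indicator_apply, Set.mem_ofPred_eq]
  simp only [h1]
  by_cases hv : v = 0
  · simp [hv]
  · simp [hv]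

section kernel

variable {ω₁ ω₂ : ℂ}

/-- The function `u ↦ ζ(2ω₁u)`. -/
noncomputable def scaledZeta (ω₁ ω₂ u : ℂ) : ℂ := weierstrassZeta ω₁ ω₂ (2 * ω₁ * u)

theorem mul_mem_doublePeriods_iff (h : 0 < (ω₂ / ω₁).im) {u : ℂ} :
    2 * ω₁ * u ∈ (doublePeriods ω₁ ω₂ h).lattice ↔ ∃ m n : ℤ, u = m + n * (ω₂ / ω₁) := by
  have h0 : ω₁ ≠ 0 := by rintro rfl; simp at h
  rw [PeriodPair.mem_lattice]
  refine exists_congr fun m => exists_congr fun n => ?_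
  simp only [doublePeriods]
  constructor
  · intro h1
    field_simp
    linear_combination -h1 / 2
  · rintro rfl
    field_simp

theorem scaledZeta_neg (h : 0 < (ω₂ / ω₁).im) (u : ℂ) :
    scaledZeta ω₁ ω₂ (-u) = -scaledZeta ω₁ ω₂ u := by
  simp only [scaledZeta, weierstrassZeta_eq h, mul_neg, latticeZeta_neg]

theorem scaledZeta_add (h : 0 < (ω₂ / ω₁).im) (m n : ℤ) :
    ∃ c, ∀ u, (¬ ∃ m n : ℤ, u = m + n * (ω₂ / ω₁)) →
      scaledZeta ω₁ ω₂ (u + (m + n * (ω₂ / ω₁))) = scaledZeta ω₁ ω₂ u + c := by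
  obtain ⟨c, hc⟩ := latticeZeta_add (doublePeriods ω₁ ω₂ h)
    ⟨2 * ω₁ * (m + n * (ω₂ / ω₁)), (mul_mem_doublePeriods_iff h).2 ⟨m, n, rfl⟩⟩
  refine ⟨c, fun u hu => ?_⟩
  simp only [scaledZeta, weierstrassZeta_eq h, mul_add (2 * ω₁) u]
  exact hc _ (by rwa [mul_mem_doublePeriods_iff])

theorem analyticAt_scaledZeta (h : 0 < (ω₂ / ω₁).im) {u : ℂ}
    (hu : ¬ ∃ m n : ℤ, u = m + n * (ω₂ / ω₁)) : AnalyticAt ℂ (scaledZeta ω₁ ω₂) u := by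
  have h1 : scaledZeta ω₁ ω₂ = fun u => latticeZeta (doublePeriods ω₁ ω₂ h) (2 * ω₁ * u) :=
    funext fun u => weierstrassZeta_eq h _
  rw [h1]
  exact AnalyticAt.fun_comp (analyticAt_latticeZeta _ (by rwa [mul_mem_doublePeriods_iff]))
    (by fun_prop)

theorem scaledZeta_simplePole (h : 0 < (ω₂ / ω₁).im) (m n : ℤ) :
    HasSimplePole (scaledZeta ω₁ ω₂) (m + n * (ω₂ / ω₁)) (1 / (2 * ω₁)) := by
  have h0 : ω₁ ≠ 0 := by rintro rfl; simp at h
  have h1 : scaledZeta ω₁ ω₂ = fun u => latticeZeta (doublePeriods ω₁ ω₂ h) (2 * ω₁ * u + 0) :=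
    funext fun u => by rw [add_zero]; exact weierstrassZeta_eq h _
  rw [h1]
  refine HasSimplePole.comp_affine (mul_ne_zero two_ne_zero h0) ?_
  rw [add_zero]
  exact latticeZeta_simplePole _ ((mul_mem_doublePeriods_iff h).2 ⟨m, n, rfl⟩)

theorem kernel_eq (γ u : ℂ) : kernel ω₁ ω₂ γ u =
    scaledZeta ω₁ ω₂ (u - γ) - 2 * scaledZeta ω₁ ω₂ u + scaledZeta ω₁ ω₂ (u + γ) := rfl

theorem kernel_neg (h : 0 < (ω₂ / ω₁).im) (γ u : ℂ) :
    kernel ω₁ ω₂ γ (-u) = -kernel ω₁ ω₂ γ u := by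
  simp only [kernel_eq, show -u - γ = -(u + γ) by ring, show -u + γ = -(u - γ) by ring,
    scaledZeta_neg h]
  ring

theorem not_exists_lattice_of_im {δ u : ℂ} (h1 : 0 < u.im) (h2 : u.im < δ.im) :
    ¬ ∃ m n : ℤ, u = m + n * δ := by
  rintro ⟨m, n, rfl⟩
  simp only [add_im, intCast_im, zero_add, mul_im, intCast_re, zero_mul, add_zero] at h1 h2
  have hδ : 0 < δ.im := h1.trans h2
  have h7 : (0 : ℝ) < n := pos_of_mul_pos_left h1 hδ.le
  have h8 : (n : ℝ) < 1 := lt_of_mul_lt_mul_right (by rwa [one_mul]) hδ.le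
  have h9 : 0 < n := by exact_mod_cast h7
  have h10 : n < 1 := by exact_mod_cast h8
  omega

theorem exists_int_of_lattice_of_im {δ u : ℂ} (h1 : -δ.im < u.im) (h2 : u.im < δ.im)
    (h : ∃ m n : ℤ, u = m + n * δ) : ∃ n : ℤ, u = n := by
  obtain ⟨m, n, rfl⟩ := h
  simp only [add_im, intCast_im, zero_add, mul_im, intCast_re, zero_mul, add_zero] at h1 h2
  have hδ : 0 < δ.im := by linarith
  have h7 : (-1 : ℝ) < n := lt_of_mul_lt_mul_right (by linarith) hδ.le
  have h8 : (n : ℝ) < 1 := lt_of_mul_lt_mul_right (by linarith) hδ.le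
  have h9 : -1 < n := by exact_mod_cast h7
  have h10 : n < 1 := by exact_mod_cast h8
  obtain rfl : n = 0 := by omega
  exact ⟨m, by simp⟩

/-- The poles of the kernel. -/
def kernelPoles (δ γ : ℂ) : Set ℂ :=
  {u | (∃ m n : ℤ, u = m + n * δ) ∨ (∃ m n : ℤ, u - γ = m + n * δ) ∨
    ∃ m n : ℤ, u + γ = m + n * δ}

theorem ofReal_notMem_kernelPoles {δ γ : ℂ} (hγ : 0 < γ.im) (hγδ : γ.im < δ.im) {u : ℝ}
    (hu : ∀ n : ℤ, u ≠ n) : (u : ℂ) ∉ kernelPoles δ γ := by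
  rintro (h | ⟨m, n, hmn⟩ | h)
  · obtain ⟨n, hn⟩ := exists_int_of_lattice_of_im (by simp; linarith) (by simp; linarith) h
    exact hu n (by exact_mod_cast hn)
  · refine not_exists_lattice_of_im (δ := δ) (u := γ - u) (by simpa) (by simpa) ⟨-m, -n, ?_⟩
    push_cast
    linear_combination -hmn
  · exact not_exists_lattice_of_im (by simpa) (by simpa) h

theorem add_notMem_kernelPoles {δ γ u : ℂ} (hu : u ∉ kernelPoles δ γ) (m n : ℤ) :
    u + (m + n * δ) ∉ kernelPoles δ γ := by
  rintro (⟨m', n', h⟩ | ⟨m', n', h⟩ | ⟨m', n', h⟩)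
  · exact hu (Or.inl ⟨m' - m, n' - n, by push_cast; linear_combination h⟩)
  · exact hu (Or.inr (Or.inl ⟨m' - m, n' - n, by push_cast; linear_combination h⟩))
  · exact hu (Or.inr (Or.inr ⟨m' - m, n' - n, by push_cast; linear_combination h⟩))

theorem eventually_notMem_kernelPoles (h : 0 < (ω₂ / ω₁).im) (γ u : ℂ) :
    ∀ᶠ v in 𝓝[≠] u, v ∉ kernelPoles (ω₂ / ω₁) γ := by
  have h0 : ω₁ ≠ 0 := by rintro rfl; simp at h
  have key : ∀ b : ℂ, ∀ᶠ v in 𝓝[≠] u, ¬ ∃ m n : ℤ, v + b = m + n * (ω₂ / ω₁) := by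
    intro b
    have h1 : ∀ᶠ v in 𝓝[≠] (2 * ω₁ * u + 2 * ω₁ * b), v ∉ (doublePeriods ω₁ ω₂ h).lattice := by
      filter_upwards [nhdsWithin_le_nhds
        ((doublePeriods ω₁ ω₂ h).compl_lattice_sdiff_singleton_mem_nhds _),
        self_mem_nhdsWithin] with v hv hv' hl using hv ⟨hl, hv'⟩
    filter_upwards [(tendsto_affine_punctured (mul_ne_zero two_ne_zero h0) (2 * ω₁ * b) u).eventually
      h1] with v hv
    rwa [← mul_add, mul_mem_doublePeriods_iff] at hv
  filter_upwards [key 0, key (-γ), key γ] with v h1 h2 h3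
  rw [add_zero] at h1
  rw [← sub_eq_add_neg] at h2
  rintro (h4 | h4 | h4)
  exacts [h1 h4, h2 h4, h3 h4]

/-- The additive constant of `scaledZeta` enters with weights `1, -2, 1` and cancels. -/
theorem kernel_add (h : 0 < (ω₂ / ω₁).im) {γ u : ℂ} (hu : u ∉ kernelPoles (ω₂ / ω₁) γ) (m n : ℤ) :
    kernel ω₁ ω₂ γ (u + (m + n * (ω₂ / ω₁))) = kernel ω₁ ω₂ γ u := by
  obtain ⟨c, hc⟩ := scaledZeta_add h m n
  simp only [kernelPoles, Set.mem_ofPred_eq, not_or] at hu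
  obtain ⟨h1, h2, h3⟩ := hu
  simp only [kernel_eq]
  rw [show u + (m + n * (ω₂ / ω₁)) - γ = u - γ + (m + n * (ω₂ / ω₁)) by ring,
    add_right_comm u _ γ, hc _ h1, hc _ h2, hc _ h3]
  ring

theorem analyticAt_kernel (h : 0 < (ω₂ / ω₁).im) {γ u : ℂ} (hu : u ∉ kernelPoles (ω₂ / ω₁) γ) :
    AnalyticAt ℂ (kernel ω₁ ω₂ γ) u := by
  simp only [kernelPoles, Set.mem_ofPred_eq, not_or] at hu
  obtain ⟨h1, h2, h3⟩ := hu
  have h4 := analyticAt_scaledZeta h h1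
  have h5 : AnalyticAt ℂ (fun u => scaledZeta ω₁ ω₂ (u - γ)) u :=
    (analyticAt_scaledZeta h h2).fun_comp (f := fun v : ℂ => v - γ) (by fun_prop)
  have h6 : AnalyticAt ℂ (fun u => scaledZeta ω₁ ω₂ (u + γ)) u :=
    (analyticAt_scaledZeta h h3).fun_comp (f := fun v : ℂ => v + γ) (by fun_prop)
  change AnalyticAt ℂ (fun u => scaledZeta ω₁ ω₂ (u - γ) - 2 * scaledZeta ω₁ ω₂ u
    + scaledZeta ω₁ ω₂ (u + γ)) u
  fun_prop

end kernel

/-! ### Principal values -/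

theorem isCompact_truncatedPeriod (x r : ℝ) : IsCompact (truncatedPeriod x r) := by
  have : truncatedPeriod x r =
      Set.Icc (-1 / 2 : ℝ) (1 / 2) ∩ ⋂ n : ℤ, {y | r ≤ |y - (x + n)|} := by
    ext y; simp [truncatedPeriod]
  rw [this]
  refine isCompact_Icc.inter_right (isClosed_iInter fun n => ?_)
  exact isClosed_le continuous_const (by fun_prop)

theorem measurableSet_truncatedPeriod (x r : ℝ) : MeasurableSet (truncatedPeriod x r) :=
  (isCompact_truncatedPeriod x r).measurableSet

theorem ne_of_mem_truncatedPeriod {x r y : ℝ} (hr : 0 < r) (hy : y ∈ truncatedPeriod x r)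
    (n : ℤ) : y ≠ x + n := by
  rintro rfl
  have := hy.2 n
  simp at this
  linarith

theorem HasPrincipalValue.congr {x : ℝ} {f g : ℝ → ℂ} {v : ℂ} (hf : HasPrincipalValue x f v)
    (h : ∀ y : ℝ, (∀ n : ℤ, y ≠ x + n) → g y = f y) : HasPrincipalValue x g v := by
  have hfg : ∀ r, 0 < r → Set.EqOn f g (truncatedPeriod x r) := fun r hr y hy =>
    (h y (ne_of_mem_truncatedPeriod hr hy)).symm
  refine ⟨fun r hr => (hf.1 r hr).congr_fun (hfg r hr) (measurableSet_truncatedPeriod x r), ?_⟩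
  refine hf.2.congr' ?_
  filter_upwards [self_mem_nhdsWithin] with r hr
  exact setIntegral_congr_fun (measurableSet_truncatedPeriod x r) (hfg r hr)

theorem HasPrincipalValue.add {x : ℝ} {f g : ℝ → ℂ} {v w : ℂ} (hf : HasPrincipalValue x f v)
    (hg : HasPrincipalValue x g w) : HasPrincipalValue x (fun y => f y + g y) (v + w) := by
  refine ⟨fun r hr => (hf.1 r hr).add (hg.1 r hr), ?_⟩
  refine (hf.2.add hg.2).congr' ?_
  filter_upwards [self_mem_nhdsWithin] with r hr
  exact (integral_add (hf.1 r hr) (hg.1 r hr)).symm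

theorem HasPrincipalValue.const_mul {x : ℝ} {f : ℝ → ℂ} {v : ℂ} (hf : HasPrincipalValue x f v)
    (c : ℂ) : HasPrincipalValue x (fun y => c * f y) (c * v) := by
  refine ⟨fun r hr => (hf.1 r hr).const_mul c, ?_⟩
  refine (hf.2.const_mul c).congr fun r => ?_
  exact (integral_const_mul c _).symm

theorem HasPrincipalValue.sub {x : ℝ} {f g : ℝ → ℂ} {v w : ℂ} (hf : HasPrincipalValue x f v)
    (hg : HasPrincipalValue x g w) : HasPrincipalValue x (fun y => f y - g y) (v - w) := by
  simpa [sub_eq_add_neg] using hf.add (hg.const_mul (-1))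

/-- Dominated convergence: a point outside the countable set `x + ℤ` belongs to the truncated
interval as soon as `r` is below its distance to that set. -/
theorem hasPrincipalValue_of_continuous {f : ℝ → ℂ} (hf : Continuous f) (x : ℝ) :
    HasPrincipalValue x f (∫ y in (-1 / 2 : ℝ)..(1 / 2), f y) := by
  refine ⟨fun r _ => hf.continuousOn.integrableOn_compact (isCompact_truncatedPeriod x r), ?_⟩
  have h1 : ∀ r, ∫ y in truncatedPeriod x r, f y =
      ∫ y in Set.Icc (-1 / 2 : ℝ) (1 / 2), (truncatedPeriod x r).indicator f y := by
    intro r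
    rw [setIntegral_indicator (measurableSet_truncatedPeriod x r),
      Set.inter_eq_right.2 fun y hy => hy.1]
  rw [intervalIntegral.integral_of_le (by norm_num), ← integral_Icc_eq_integral_Ioc]
  simp only [h1]
  have hint : IntegrableOn f (Set.Icc (-1 / 2 : ℝ) (1 / 2)) :=
    hf.continuousOn.integrableOn_compact isCompact_Icc
  refine tendsto_integral_filter_of_dominated_convergence (fun y => ‖f y‖) ?_ ?_ hint.norm ?_
  · exact Eventually.of_forall fun r =>
      (hint.aestronglyMeasurable).indicator (measurableSet_truncatedPeriod x r)
  · exact Eventually.of_forall fun r => Eventually.of_forall fun y => norm_indicator_le_norm_self f y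
  · have hc : (Set.range fun n : ℤ => x + n).Countable := Set.countable_range _
    rw [ae_restrict_iff' measurableSet_Icc]
    filter_upwards [hc.ae_notMem volume] with y hy hyI
    have hpos : 0 < |y - (x + round (y - x))| := by
      rw [abs_pos, sub_ne_zero]
      exact fun h => hy ⟨_, h.symm⟩
    refine tendsto_const_nhds.congr' ?_
    filter_upwards [Ioo_mem_nhdsGT hpos] with r hr
    rw [Set.indicator_of_mem]
    refine ⟨hyI, fun n => hr.2.le.trans ?_⟩
    have := round_le (y - x) n
    rwa [sub_sub, sub_sub] at this

/-- The truncated integrals already vanish for every `r`: by periodicity they may be taken over the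
period centred at `x`, where reflection in `x` changes their sign. -/
theorem hasPrincipalValue_of_odd {f : ℝ → ℂ} {x : ℝ}
    (hf : ∀ y : ℝ, (∀ n : ℤ, y ≠ x + n) → ContinuousAt f y)
    (hper : ∀ y : ℝ, (∀ n : ℤ, y ≠ x + n) → f (y + 1) = f y)
    (hodd : ∀ y : ℝ, (∀ n : ℤ, y ≠ x + n) → f (2 * x - y) = -f y) :
    HasPrincipalValue x f 0 := by
  refine ⟨fun r hr => ContinuousOn.integrableOn_compact (isCompact_truncatedPeriod x r)
    (fun y hy => (hf y (ne_of_mem_truncatedPeriod hr hy)).continuousWithinAt), ?_⟩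
  refine tendsto_const_nhds.congr' ?_
  filter_upwards [self_mem_nhdsWithin] with r hr
  rw [Set.mem_Ioi] at hr
  set S : Set ℝ := {y | ∀ n : ℤ, r ≤ |y - (x + n)|} with hS
  have hSne : ∀ y ∈ S, ∀ n : ℤ, y ≠ x + n := by
    rintro _ hy n rfl
    have := hy n
    simp at this
    linarith
  have hSm : MeasurableSet S := by
    have : S = ⋂ n : ℤ, {y | r ≤ |y - (x + n)|} := by ext y; simp [hS]
    rw [this]
    exact (isClosed_iInter fun n => isClosed_le continuous_const (by fun_prop)).measurableSet
  have hS1 : ∀ y, y + 1 ∈ S ↔ y ∈ S := by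
    intro y
    constructor
    · intro h n
      have := h (n + 1)
      push_cast at this
      rwa [show y + 1 - (x + (n + 1)) = y - (x + n) by ring] at this
    · intro h n
      have := h (n - 1)
      push_cast at this
      rwa [show y - (x + (n - 1)) = y + 1 - (x + n) by ring] at this
  have hS2' : ∀ y, y ∈ S → 2 * x - y ∈ S := by
    intro y h n
    have := h (-n)
    push_cast at this
    rw [abs_sub_comm]
    rwa [show y - (x + -n) = x + n - (2 * x - y) by ring] at this
  have hS2 : ∀ y, 2 * x - y ∈ S ↔ y ∈ S := fun y =>
    ⟨fun h => by simpa using hS2' _ h, hS2' y⟩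
  set g : ℝ → ℂ := S.indicator f with hg
  have hg1 : Function.Periodic g 1 := by
    intro y
    by_cases hy : y ∈ S
    · rw [hg, Set.indicator_of_mem ((hS1 y).2 hy), Set.indicator_of_mem hy, hper y (hSne y hy)]
    · rw [hg, Set.indicator_of_notMem (mt (hS1 y).1 hy), Set.indicator_of_notMem hy]
  have hg2 : ∀ y, g (2 * x - y) = -g y := by
    intro y
    by_cases hy : y ∈ S
    · rw [hg, Set.indicator_of_mem ((hS2 y).2 hy), Set.indicator_of_mem hy, hodd y (hSne y hy)]
    · rw [hg, Set.indicator_of_notMem (mt (hS2 y).1 hy), Set.indicator_of_notMem hy, neg_zero]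
  have h1 : ∫ y in truncatedPeriod x r, f y = ∫ y in (-1 / 2 : ℝ)..(1 / 2), g y := by
    rw [intervalIntegral.integral_of_le (by norm_num), ← integral_Icc_eq_integral_Ioc, hg,
      setIntegral_indicator hSm]
    rfl
  have h2 : ∫ y in (-1 / 2 : ℝ)..(1 / 2), g y = ∫ y in (x - 1 / 2)..(x + 1 / 2), g y := by
    have := hg1.intervalIntegral_add_eq (-1 / 2) (x - 1 / 2)
    rwa [show (-1 / 2 : ℝ) + 1 = 1 / 2 by norm_num,
      show x - 1 / 2 + 1 = x + 1 / 2 by ring] at this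
  have h3 : ∫ y in (x - 1 / 2)..(x + 1 / 2), g y = -∫ y in (x - 1 / 2)..(x + 1 / 2), g y := by
    have := intervalIntegral.integral_comp_sub_left (a := x - 1 / 2) (b := x + 1 / 2) g (2 * x)
    simp only [hg2] at this
    rw [intervalIntegral.integral_neg, show 2 * x - (x + 1 / 2) = x - 1 / 2 by ring,
      show 2 * x - (x - 1 / 2) = x + 1 / 2 by ring] at this
    exact this.symm
  rw [h1, h2]
  linear_combination -(1 / 2 : ℂ) * h3

/-! ### The cotangent kernel -/

/-- The function `π cot(πz)`. -/
noncomputable def cotKernel (z : ℂ) : ℂ :=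
  Real.pi * I * (exp (2 * Real.pi * I * z) + 1) / (exp (2 * Real.pi * I * z) - 1)

theorem cotKernel_add_one (z : ℂ) : cotKernel (z + 1) = cotKernel z := by
  simp only [cotKernel, exp_add_two_pi_mul]

theorem cotKernel_neg (z : ℂ) : cotKernel (-z) = -cotKernel z := by
  have h : exp (2 * Real.pi * I * -z) = (exp (2 * Real.pi * I * z))⁻¹ := by
    rw [← exp_neg, mul_neg]
  simp only [cotKernel, h]
  have h0 := exp_ne_zero (2 * Real.pi * I * z)
  set e := exp (2 * Real.pi * I * z)
  -- At a pole both sides are `0` by the convention for division by zero.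
  by_cases h1 : e = 1
  · simp [h1]
  · have h2 : e - 1 ≠ 0 := sub_ne_zero.2 h1
    have h3 : 1 - e ≠ 0 := sub_ne_zero.2 (Ne.symm h1)
    have h4 : e⁻¹ - 1 = (1 - e) / e := by field_simp
    rw [h4]
    field_simp
    ring

theorem analyticAt_cotKernel {z : ℂ} (hz : ∀ n : ℤ, z ≠ n) : AnalyticAt ℂ cotKernel z := by
  have h : exp (2 * Real.pi * I * z) - 1 ≠ 0 := by
    rw [sub_ne_zero, Ne, exp_two_pi_mul_eq_one_iff]
    simpa using hz
  unfold cotKernel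
  fun_prop (disch := assumption)

theorem ne_int_of_im_ne_zero {z : ℂ} (hz : z.im ≠ 0) (n : ℤ) : z ≠ n := by
  rintro rfl
  simp at hz

theorem cotKernel_simplePole (n : ℤ) : HasSimplePole cotKernel n 1 := by
  have h1 : HasDerivAt (fun z : ℂ => exp (2 * Real.pi * I * z) - 1) (2 * Real.pi * I) n := by
    have := (((hasDerivAt_id (n : ℂ)).const_mul (2 * Real.pi * I)).cexp).sub_const 1
    have he : exp (2 * Real.pi * I * n) = 1 := exp_two_pi_mul_eq_one_iff.2 ⟨n, rfl⟩
    simpa [he] using this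
  have he : exp (2 * Real.pi * I * n) = 1 := exp_two_pi_mul_eq_one_iff.2 ⟨n, rfl⟩
  have h2 := HasSimplePole.div_of_simple_zero (p := (n : ℂ))
    (f := fun z : ℂ => Real.pi * I * (exp (2 * Real.pi * I * z) + 1))
    (g := fun z : ℂ => exp (2 * Real.pi * I * z) - 1) (by fun_prop) (by fun_prop)
    (by rw [he, sub_self]) (by rw [h1.deriv]; exact two_pi_I_ne_zero)
  rw [h1.deriv, he, show (Real.pi : ℂ) * I * (1 + 1) = 2 * Real.pi * I by ring,
    div_self two_pi_I_ne_zero] at h2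
  exact h2

theorem continuous_cotKernel_sub {p : ℂ} (hp : p.im ≠ 0) :
    Continuous fun y : ℝ => cotKernel (y - p) := by
  refine continuous_iff_continuousAt.2 fun y => ?_
  have h1 : AnalyticAt ℂ cotKernel (y - p) :=
    analyticAt_cotKernel (ne_int_of_im_ne_zero (by simpa using hp))
  exact ContinuousAt.comp' (g := cotKernel) (f := fun y : ℝ => (y : ℂ) - p) h1.continuousAt
    (by fun_prop)

/-- With `e = e^{2πi(y-p)}` a primitive is `-πi y + log (1 - e)`; since `‖e‖ < 1` the principal
logarithm is smooth along the path, and being periodic it contributes nothing. -/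
theorem integral_cotKernel_of_im_neg {p : ℂ} (hp : p.im < 0) :
    ∫ y in (-1 / 2 : ℝ)..(1 / 2), cotKernel (y - p) = -(Real.pi * I) := by
  set e : ℝ → ℂ := fun y => exp (2 * Real.pi * I * (y - p)) with he
  have hlt : ∀ y : ℝ, ‖e y‖ < 1 := fun y => norm_nome_lt_one (by simpa using hp)
  have hder : ∀ y : ℝ, HasDerivAt (fun y : ℝ => -(Real.pi * I) * y + log (1 - e y))
      (cotKernel (y - p)) y := by
    intro y
    have h1 : HasDerivAt e (e y * (2 * Real.pi * I)) y := by
      have := ((((hasDerivAt_id y).ofReal_comp).sub_const p).const_mul (2 * Real.pi * I)).cexp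
      simpa using this
    have hs : 1 - e y ∈ slitPlane := by
      refine Or.inl ?_
      have := (re_le_norm (e y)).trans_lt (hlt y)
      simpa using this
    have h2 := (h1.const_sub 1).clog_real hs
    have h3 := (((hasDerivAt_id y).ofReal_comp).const_mul (-(Real.pi * I : ℂ))).add h2
    simp only [id, ofReal_one, mul_one] at h3
    refine h3.congr_deriv ?_
    have h0 : 1 - e y ≠ 0 := slitPlane_ne_zero hs
    have h0' : e y - 1 ≠ 0 := by
      rw [← neg_ne_zero, neg_sub]; exact h0
    change _ = Real.pi * I * (e y + 1) / (e y - 1)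
    rw [← neg_sub (e y) 1]
    field_simp
    ring
  rw [intervalIntegral.integral_eq_sub_of_hasDerivAt (fun y _ => hder y)
    ((continuous_cotKernel_sub hp.ne).intervalIntegrable _ _)]
  have h5 : e (1 / 2) = e (-1 / 2) := by
    simp only [he]
    rw [← exp_add_two_pi_mul (((-1 / 2 : ℝ) : ℂ) - p)]
    push_cast
    ring_nf
  rw [h5]
  push_cast
  ring

theorem integral_cotKernel_of_im_pos {p : ℂ} (hp : 0 < p.im) :
    ∫ y in (-1 / 2 : ℝ)..(1 / 2), cotKernel (y - p) = Real.pi * I := by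
  have h1 := integral_cotKernel_of_im_neg (p := -p) (by simpa using hp)
  have h2 := intervalIntegral.integral_comp_neg (a := (-1 / 2 : ℝ)) (b := 1 / 2)
    (fun y : ℝ => cotKernel (y - p))
  have h3 : ∀ y : ℝ, cotKernel (((-y : ℝ) : ℂ) - p) = -cotKernel (y - -p) := by
    intro y
    rw [← cotKernel_neg]
    push_cast
    ring_nf
  simp only [h3] at h2
  rw [intervalIntegral.integral_neg, h1] at h2
  norm_num at h2 ⊢
  exact h2.symm

theorem hasPrincipalValue_cotKernel (x : ℝ) :
    HasPrincipalValue x (fun y : ℝ => cotKernel (y - x)) 0 := by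
  refine hasPrincipalValue_of_odd (fun y hy => ?_) (fun y _ => ?_) (fun y _ => ?_)
  · have h1 : AnalyticAt ℂ cotKernel (y - x) := analyticAt_cotKernel fun n h => hy n (by
      have : (y : ℂ) = x + n := by linear_combination h
      exact_mod_cast this)
    exact ContinuousAt.comp' (g := cotKernel) (f := fun y : ℝ => (y : ℂ) - x) h1.continuousAt
      (by fun_prop)
  · rw [← cotKernel_add_one ((y : ℂ) - x)]
    push_cast
    ring_nf
  · rw [← cotKernel_neg]
    push_cast
    ring_nf

/-! ### Shift of the contour -/

/-- Cauchy's theorem on a rectangle of width one: periodicity cancels the vertical sides and absorbs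
the horizontal shift by `T.re`. -/
theorem integral_shift_of_periodic {H : ℂ → ℂ} {T : ℂ} (hT : 0 < T.im)
    (hH : ∀ z : ℂ, 0 ≤ z.im → z.im ≤ T.im → AnalyticAt ℂ H z) (hper : ∀ z, H (z + 1) = H z) :
    ∫ y in (-1 / 2 : ℝ)..(1 / 2), H (y + T) = ∫ y in (-1 / 2 : ℝ)..(1 / 2), H y := by
  have h1 := Complex.integral_boundary_rect_eq_zero_of_differentiableOn H ((-1 / 2 : ℝ) : ℂ)
    (((1 / 2 : ℝ) : ℂ) + T.im * I) (fun z hz => by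
      have := hz.2
      simp [Set.uIcc_of_le hT.le] at this
      exact (hH z this.1 this.2).differentiableAt.differentiableWithinAt)
  simp only [ofReal_re, ofReal_im, add_re, add_im, mul_re, mul_im, I_re, I_im, mul_zero, mul_one,
    zero_mul, sub_zero, add_zero, zero_add, ofReal_zero] at h1
  have h2 : ∀ y : ℝ, H (((1 / 2 : ℝ) : ℂ) + y * I) = H (((-1 / 2 : ℝ) : ℂ) + y * I) := by
    intro y
    rw [← hper (((-1 / 2 : ℝ) : ℂ) + y * I)]
    congr 1
    push_cast
    ring
  simp only [h2] at h1
  set g : ℝ → ℂ := fun y => H (y + T.im * I) with hg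
  have hgp : Function.Periodic g 1 := by
    intro y
    simp only [hg]
    rw [← hper ((y : ℂ) + T.im * I)]
    congr 1
    push_cast
    ring
  have h3 : ∀ y : ℝ, H (y + T) = g (y + T.re) := by
    intro y
    simp only [hg]
    congr 1
    push_cast
    rw [add_assoc, re_add_im]
  have h4 : ∫ y in (-1 / 2 : ℝ)..(1 / 2), H (y + T) = ∫ y in (-1 / 2 : ℝ)..(1 / 2), g y := by
    simp only [h3]
    rw [intervalIntegral.integral_comp_add_right g T.re]
    have := hgp.intervalIntegral_add_eq (-1 / 2 + T.re) (-1 / 2)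
    rwa [show (-1 / 2 : ℝ) + 1 = 1 / 2 by norm_num,
      show -1 / 2 + T.re + 1 = 1 / 2 + T.re by ring] at this
  rw [h4]
  linear_combination -h1

/-! ### The transform of a difference of boundary values -/

section transform

variable {ω₁ ω₂ γ : ℂ} {w : ℂ → ℂ}

/-- Within this range of heights the only poles are at `a + ℤ`, where both terms have residue `w a /
(2ω₁)` because `w` is 1-periodic. The integer `n` selects the row of poles of `ζ` that is centred at
`a`. -/
theorem scaledZeta_mul_sub_cotKernel (h : 0 < (ω₂ / ω₁).im) (hper : Function.Periodic w 1)
    {a z : ℂ} (hw : AnalyticAt ℂ w z) (h1 : -(ω₂ / ω₁).im < (z - a).im)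
    (h2 : (z - a).im < (ω₂ / ω₁).im) (n : ℤ) :
    HasSimplePole (fun z => scaledZeta ω₁ ω₂ (z - a + n * (ω₂ / ω₁)) * w z
      - 1 / (2 * ω₁) * w a * cotKernel (z - a)) z 0 := by
  by_cases hz : ∃ j : ℤ, z - a = j
  · obtain ⟨j, hj⟩ := hz
    have hwa : w z = w a := by
      have := hper.int_mul j a
      rw [← this, mul_one, ← hj, add_sub_cancel]
    have h3 : HasSimplePole (fun z => scaledZeta ω₁ ω₂ (z + (-a + n * (ω₂ / ω₁)))) z
        (1 / (2 * ω₁)) := by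
      refine HasSimplePole.comp_add ?_
      rw [← add_assoc, ← sub_eq_add_neg, hj]
      exact scaledZeta_simplePole h j n
    have h4 : HasSimplePole (fun z => cotKernel (z + -a)) z 1 := by
      refine HasSimplePole.comp_add ?_
      rw [← sub_eq_add_neg, hj]
      exact cotKernel_simplePole j
    have h5 := (h3.mul_analyticAt hw).sub (h4.const_mul (1 / (2 * ω₁) * w a))
    rw [hwa, mul_one, sub_self] at h5
    simpa only [← add_assoc, ← sub_eq_add_neg] using h5
  · have h3 : ¬ ∃ m' n' : ℤ, z - a + n * (ω₂ / ω₁) = m' + n' * (ω₂ / ω₁) := by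
      rintro ⟨m', n', h'⟩
      exact hz (exists_int_of_lattice_of_im h1 h2
        ⟨m', n' - n, by push_cast; linear_combination h'⟩)
    have h4 : AnalyticAt ℂ (fun z => scaledZeta ω₁ ω₂ (z - a + n * (ω₂ / ω₁))) z :=
      (analyticAt_scaledZeta h h3).fun_comp (f := fun z : ℂ => z - a + n * (ω₂ / ω₁))
        (by fun_prop)
    have h5 : AnalyticAt ℂ (fun z => cotKernel (z - a)) z :=
      (analyticAt_cotKernel (by simpa using hz)).fun_comp (f := fun z : ℂ => z - a) (by fun_prop)
    exact .of_analyticAt (by fun_prop)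

theorem analyticAt_cotKernel_sub {a z : ℂ} (h : (z - a).im ≠ 0) :
    AnalyticAt ℂ (fun z => cotKernel (z - a)) z :=
  (analyticAt_cotKernel (ne_int_of_im_ne_zero h)).fun_comp (f := fun z : ℂ => z - a) (by fun_prop)

/-- The sum of the cotangent kernels with the poles and residues of `z ↦ kernel (z - x) * w z`
in the strip between `ℝ` and `δ + ℝ`. -/
noncomputable def polarPart (ω₁ δ γ : ℂ) (w : ℂ → ℂ) (x : ℝ) (z : ℂ) : ℂ :=
  1 / (2 * ω₁) * w (x + γ) * cotKernel (z - (x + γ))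
    + 1 / (2 * ω₁) * w (x + δ - γ) * cotKernel (z - (x + δ - γ))
    - 2 * (1 / (2 * ω₁) * w x * cotKernel (z - x))
    - 2 * (1 / (2 * ω₁) * w (x + δ) * cotKernel (z - (x + δ)))

theorem polarPart_add_one (ω₁ δ γ : ℂ) (w : ℂ → ℂ) (x : ℝ) (z : ℂ) :
    polarPart ω₁ δ γ w x (z + 1) = polarPart ω₁ δ γ w x z := by
  have : ∀ a, cotKernel (z + 1 - a) = cotKernel (z - a) := fun a => by
    rw [add_sub_right_comm, cotKernel_add_one]
  simp only [polarPart, this]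

theorem kernel_mul_sub_polarPart (h : 0 < (ω₂ / ω₁).im) (hγ : 0 < γ.im)
    (hγδ : γ.im < (ω₂ / ω₁).im) (hper : Function.Periodic w 1) (x : ℝ) {z : ℂ}
    (hw : AnalyticAt ℂ w z) (h1 : 0 ≤ z.im) (h2 : z.im ≤ (ω₂ / ω₁).im) :
    HasSimplePole (fun z => kernel ω₁ ω₂ γ (z - x) * w z - polarPart ω₁ (ω₂ / ω₁) γ w x z)
      z 0 := by
  set δ := ω₂ / ω₁ with hδ
  have p1 := scaledZeta_mul_sub_cotKernel h hper hw (a := x + γ)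
    (by simp [← hδ]; linarith) (by simp [← hδ]; linarith) 0
  have p2 := scaledZeta_mul_sub_cotKernel h hper hw (a := x + δ - γ)
    (by simp [← hδ]; linarith) (by simp [← hδ]; linarith) 1
  have p3 : HasSimplePole (fun z => scaledZeta ω₁ ω₂ (z - x) * w z
      - 1 / (2 * ω₁) * w x * cotKernel (z - x)
      - 1 / (2 * ω₁) * w (x + δ) * cotKernel (z - (x + δ))) z 0 := by
    -- No single centre covers both edges of the closed strip: below the top edge the poles are
    -- those at `x + ℤ`, on it those at `x + δ + ℤ`, and the other cotangent is analytic there.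
    by_cases hz : z.im < δ.im
    · have q1 := scaledZeta_mul_sub_cotKernel h hper hw (a := x)
        (by simp [← hδ]; linarith) (by simp [← hδ]; linarith) 0
      have q2 : AnalyticAt ℂ (fun z => cotKernel (z - (x + δ))) z :=
        analyticAt_cotKernel_sub (by simp; linarith)
      have q3 := q1.sub ((HasSimplePole.of_analyticAt q2).const_mul (1 / (2 * ω₁) * w (x + δ)))
      simpa using q3
    · have q1 := scaledZeta_mul_sub_cotKernel h hper hw (a := x + δ)
        (by simp [← hδ]; linarith) (by simp [← hδ]; linarith) 1
      have q2 : AnalyticAt ℂ (fun z => cotKernel (z - x)) z :=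
        analyticAt_cotKernel_sub (by simp; linarith)
      have q3 := q1.sub ((HasSimplePole.of_analyticAt q2).const_mul (1 / (2 * ω₁) * w x))
      simp only [mul_zero, sub_zero] at q3
      refine q3.congr (Eventually.of_forall fun v => ?_)
      simp only [← hδ, Int.cast_one, one_mul, show v - (x + δ) + δ = v - x by ring]
      ring
  have p4 := (p1.add p2).sub (p3.const_mul 2)
  simp only [mul_zero, sub_zero, add_zero] at p4
  refine p4.congr (Eventually.of_forall fun v => ?_)
  simp only [← hδ, Int.cast_one, Int.cast_zero, zero_mul, one_mul, add_zero,
    show v - (x + δ - γ) + δ = v - x + γ by ring, show v - (x + γ) = v - x - γ by ring,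
    polarPart, kernel_eq]
  ring

theorem hasPrincipalValue_cotKernel_sub (x : ℝ) {p : ℂ} {s : ℂ}
    (hp : (p = x ∧ s = 0) ∨ (p.im < 0 ∧ s = -1) ∨ (0 < p.im ∧ s = 1)) :
    HasPrincipalValue x (fun y : ℝ => cotKernel (y - p)) (s * (Real.pi * I)) := by
  rcases hp with ⟨rfl, rfl⟩ | ⟨h, rfl⟩ | ⟨h, rfl⟩
  · simpa using hasPrincipalValue_cotKernel x
  · have := hasPrincipalValue_of_continuous (continuous_cotKernel_sub h.ne) x
    rw [integral_cotKernel_of_im_neg h] at this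
    simpa using this
  · have := hasPrincipalValue_of_continuous (continuous_cotKernel_sub h.ne') x
    rw [integral_cotKernel_of_im_pos h] at this
    simpa using this

/-- For a pole `p` inside the strip, `p` is above the real line and `p - δ` below, giving `πi -
(-πi) = 2πi`. For `p = x` and `p = x + δ` one of the two points lies on the line and gives `0`,
leaving `πi`; the weight `2` makes up for it. -/
theorem hasPrincipalValue_polarPart {δ : ℂ} (hγ : 0 < γ.im) (hγδ : γ.im < δ.im) (x : ℝ) :
    HasPrincipalValue x
      (fun y : ℝ => polarPart ω₁ δ γ w x y - polarPart ω₁ δ γ w x (y + δ))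
      (1 / (2 * ω₁) * (2 * (Real.pi * I)) * (w (x + γ) + w (x + δ - γ) - w x - w (x + δ))) := by
  have hδ : 0 < δ.im := hγ.trans hγδ
  have a1 := hasPrincipalValue_cotKernel_sub x (p := x + γ) (s := 1) (by simp [hγ])
  have a2 := hasPrincipalValue_cotKernel_sub x (p := x + δ - γ) (s := 1) (by simp [hγδ])
  have a3 := hasPrincipalValue_cotKernel_sub x (p := x) (s := 0) (by simp)
  have a4 := hasPrincipalValue_cotKernel_sub x (p := x + δ) (s := 1) (by simp [hδ])
  have b1 := hasPrincipalValue_cotKernel_sub x (p := x + γ - δ) (s := -1) (by simp [hγδ])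
  have b2 := hasPrincipalValue_cotKernel_sub x (p := x - γ) (s := -1) (by simp [hγ])
  have b3 := hasPrincipalValue_cotKernel_sub x (p := x - δ) (s := -1) (by simp [hδ])
  have e := (((((a1.sub b1).const_mul (1 / (2 * ω₁) * w (x + γ))).add
    ((a2.sub b2).const_mul (1 / (2 * ω₁) * w (x + δ - γ)))).sub
    ((a3.sub b3).const_mul (2 * (1 / (2 * ω₁) * w x)))).sub
    ((a4.sub a3).const_mul (2 * (1 / (2 * ω₁) * w (x + δ)))))
  convert e.congr fun y _ => ?_ using 1
  · ring
  · simp only [polarPart, show (y : ℂ) + δ - (x + γ) = y - (x + γ - δ) by ring,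
      show (y : ℂ) + δ - (x + δ - γ) = y - (x - γ) by ring,
      show (y : ℂ) + δ - x = y - (x - δ) by ring,
      show (y : ℂ) + δ - (x + δ) = y - x by ring]
    ring

theorem hasPrincipalValue_kernel (h : 0 < (ω₂ / ω₁).im) (hγ : 0 < γ.im)
    (hγδ : γ.im < (ω₂ / ω₁).im) (x : ℝ) :
    HasPrincipalValue x (fun y : ℝ => kernel ω₁ ω₂ γ (y - x)) 0 := by
  have hreg : ∀ y : ℝ, (∀ n : ℤ, y ≠ x + n) → (y : ℂ) - x ∉ kernelPoles (ω₂ / ω₁) γ := by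
    intro y hy
    rw [← ofReal_sub]
    exact ofReal_notMem_kernelPoles hγ hγδ fun n hn => hy n (by linarith)
  refine hasPrincipalValue_of_odd (fun y hy => ?_) (fun y hy => ?_) (fun y _ => ?_)
  · exact ContinuousAt.comp' (g := kernel ω₁ ω₂ γ) (f := fun y : ℝ => (y : ℂ) - x)
      (analyticAt_kernel h (hreg y hy)).continuousAt (by fun_prop)
  · rw [← kernel_add h (hreg y hy) 1 0]
    push_cast
    ring_nf
  · rw [← kernel_neg h]
    push_cast
    ring_nf

/-- After the cotangents are removed, what remains of `K(z-x) w(z)` extends holomorphically over the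
strip and has equal integrals on both edges, so `polarPart` alone determines the answer. -/
theorem hasTransform_sub_shift (h : 0 < (ω₂ / ω₁).im) (hγ : 0 < γ.im)
    (hγδ : γ.im < (ω₂ / ω₁).im) (hper : Function.Periodic w 1)
    (hw : ∀ z : ℂ, 0 ≤ z.im → z.im ≤ (ω₂ / ω₁).im → AnalyticAt ℂ w z) (c : ℂ) (x : ℝ) :
    HasTransform ω₁ ω₂ γ (fun y => w y - w (y + ω₂ / ω₁) + c) x
      (w x + w (x + ω₂ / ω₁) - w (x + γ) - w (x + ω₂ / ω₁ - γ)) := by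
  have h0 : ω₁ ≠ 0 := by rintro rfl; simp at h
  set δ := ω₂ / ω₁ with hδ
  set G : ℂ → ℂ := fun z => kernel ω₁ ω₂ γ (z - x) * w z - polarPart ω₁ δ γ w x z with hG
  have hH : ∀ z : ℂ, 0 ≤ z.im → z.im ≤ δ.im → AnalyticAt ℂ (regularize G) z := fun z h1 h2 =>
    (kernel_mul_sub_polarPart h hγ hγδ hper x (hw z h1 h2) h1 h2).analyticAt_regularize
  have hHper : ∀ z, regularize G (z + 1) = regularize G z := by
    intro z
    refine regularize_add_of_periodic ?_
    have h1 : ∀ᶠ v : ℂ in 𝓝[≠] z, v - x ∉ kernelPoles δ γ := by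
      have := (tendsto_affine_punctured one_ne_zero (-(x : ℂ)) z).eventually
        (eventually_notMem_kernelPoles h γ _)
      simpa [← sub_eq_add_neg] using this
    filter_upwards [h1] with v hv
    have h2 := kernel_add h hv 1 0
    simp only [Int.cast_one, Int.cast_zero, zero_mul, add_zero] at h2
    simp only [hG, hper v, polarPart_add_one, add_sub_right_comm v 1, h2]
  have hcont : Continuous fun y : ℝ => regularize G y :=
    continuous_iff_continuousAt.2 fun y => ContinuousAt.comp' (g := regularize G)
      (f := fun y : ℝ => (y : ℂ)) (hH y (by simp) (by simpa using h.le)).continuousAt (by fun_prop)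
  have hcont' : Continuous fun y : ℝ => regularize G (y + δ) :=
    continuous_iff_continuousAt.2 fun y => ContinuousAt.comp' (g := regularize G)
      (f := fun y : ℝ => (y : ℂ) + δ) (hH (y + δ) (by simpa using h.le) (by simp)).continuousAt
      (by fun_prop)
  have hpv1 := (hasPrincipalValue_of_continuous hcont x).sub
    (hasPrincipalValue_of_continuous hcont' x)
  rw [integral_shift_of_periodic h hH hHper, sub_self] at hpv1
  have hpv := (hpv1.add (hasPrincipalValue_polarPart (ω₁ := ω₁) (w := w) hγ hγδ x)).add
    ((hasPrincipalValue_kernel h hγ hγδ x).const_mul c)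
  refine ⟨_, hpv.congr fun y hy => ?_, ?_⟩
  · have hy0 : ∀ n : ℤ, (y : ℂ) - x ≠ n := fun n hn => hy n (by
      have : (y : ℂ) = x + n := by linear_combination hn
      exact_mod_cast this)
    have hreg : (y : ℂ) - x ∉ kernelPoles δ γ := by
      rw [← ofReal_sub]
      exact ofReal_notMem_kernelPoles hγ hγδ fun n hn => hy n (by linarith)
    have hshift : (y : ℂ) + δ - x = y - x + (((0 : ℤ) : ℂ) + ((1 : ℤ) : ℂ) * δ) := by
      push_cast; ring
    have hreg' : (y : ℂ) + δ - x ∉ kernelPoles δ γ := by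
      rw [hshift]
      exact add_notMem_kernelPoles hreg 0 1
    -- The period `δ` of the kernel turns the integral along the upper edge into one of `w (y + δ)`
    -- against the same kernel.
    have hK : kernel ω₁ ω₂ γ (y + δ - x) = kernel ω₁ ω₂ γ (y - x) := by
      rw [hshift]
      exact kernel_add h hreg 0 1
    have hcot : ∀ a z : ℂ, (∀ n : ℤ, z - a ≠ n) → AnalyticAt ℂ (fun z => cotKernel (z - a)) z :=
      fun a z ha => (analyticAt_cotKernel ha).fun_comp (f := fun z : ℂ => z - a) (by fun_prop)
    have hker : ∀ z : ℂ, z - x ∉ kernelPoles δ γ →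
        AnalyticAt ℂ (fun z => kernel ω₁ ω₂ γ (z - x)) z :=
      fun z hz => (analyticAt_kernel h hz).fun_comp (f := fun z : ℂ => z - x) (by fun_prop)
    have hG1 : AnalyticAt ℂ G y := by
      have c1 := hcot (x + γ) y (ne_int_of_im_ne_zero (by simp; linarith))
      have c2 := hcot (x + δ - γ) y (ne_int_of_im_ne_zero (by simp; linarith))
      have c3 := hcot x y hy0
      have c4 := hcot (x + δ) y (ne_int_of_im_ne_zero (by simp; linarith))
      have c5 := hker y hreg
      have c6 := hw y (by simp) (by simpa using h.le)
      simp only [hG, polarPart]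
      fun_prop
    have hG2 : AnalyticAt ℂ G (y + δ) := by
      have c1 := hcot (x + γ) (y + δ) (ne_int_of_im_ne_zero (by simp; linarith))
      have c2 := hcot (x + δ - γ) (y + δ) (ne_int_of_im_ne_zero (by simp; linarith))
      have c3 := hcot x (y + δ) (ne_int_of_im_ne_zero (by simp; linarith))
      have c4 := hcot (x + δ) (y + δ) (by
        rw [show (y : ℂ) + δ - (x + δ) = y - x by ring]; exact hy0)
      have c5 := hker (y + δ) hreg'
      have c6 := hw (y + δ) (by simpa using h.le) (by simp)
      simp only [hG, polarPart]
      fun_prop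
    rw [regularize_eq_self hG1.continuousAt, regularize_eq_self hG2.continuousAt]
    simp only [hG, hK]
    ring
  · have hpi : (Real.pi : ℂ) ≠ 0 := by exact_mod_cast Real.pi_ne_zero
    field_simp
    -- The prefactors multiply to `(i ω₁ / π) * (π i / ω₁) = -1`.
    linear_combination (-(Real.pi * (w (x + γ) + w (x + δ - γ) - w x - w (x + δ)))) * I_sq

end transform

/-! ### The solution -/

section solution

variable {ω₁ ω₂ γ δ ε Δ : ℂ} {k : ℤ}

/-- `w = -∂_t τ / τ`. -/
noncomputable def tauLogDeriv (γ δ ε Δ : ℂ) (k : ℤ) (t z : ℂ) : ℂ :=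
  -(omega γ δ ε Δ k * theta1' (k * z + omega γ δ ε Δ k * t) Δ / tau γ δ ε Δ k z t)

theorem tauLogDeriv_periodic (t : ℂ) : Function.Periodic (tauLogDeriv γ δ ε Δ k t) 1 := by
  intro z
  have h1 : Function.Periodic (fun u => theta1' u Δ / theta1 u Δ) 1 := fun u => by
    simp [theta1_add_one, theta1'_add_one]
  have h2 := h1.int_mul k (k * z + omega γ δ ε Δ k * t)
  simp only [tauLogDeriv, tau, mul_div_assoc]
  rw [← h2, mul_add, mul_one, add_right_comm]

theorem analyticAt_tauLogDeriv (hΔ : 0 < Δ.im) {t z : ℂ} (h : tau γ δ ε Δ k z t ≠ 0) :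
    AnalyticAt ℂ (tauLogDeriv γ δ ε Δ k t) z := by
  have h1 := (differentiable_tau (γ := γ) (δ := δ) (ε := ε) (k := k) hΔ t).analyticAt z
  have h2 : AnalyticAt ℂ (fun z : ℂ => theta1' (k * z + omega γ δ ε Δ k * t) Δ) z :=
    ((differentiable_theta1' hΔ).analyticAt _).fun_comp
      (f := fun z : ℂ => (k : ℂ) * z + omega γ δ ε Δ k * t) (by fun_prop)
  unfold tauLogDeriv
  fun_prop (disch := assumption)

theorem eta_eq_tauLogDeriv_sub {η₀ : ℂ} (hΔ : 0 < Δ.im)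
    (h : IsBilinearSolution γ δ ε η₀ (tau γ δ ε Δ k)) {x t : ℂ}
    (h0 : tau γ δ ε Δ k x t ≠ 0) (h1 : tau γ δ ε Δ k (x + δ) t ≠ 0) :
    eta γ δ ε Δ k x t = tauLogDeriv γ δ ε Δ k t x - tauLogDeriv γ δ ε Δ k t (x + δ) + η₀ := by
  have := h.equation x t
  rw [hirotaD, (hasDerivAt_tau hΔ _ _).deriv, (hasDerivAt_tau hΔ _ _).deriv] at this
  simp only [eta, tauLogDeriv]
  generalize theta1' (k * x + omega γ δ ε Δ k * t) Δ = a at *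
  generalize theta1' (k * (x + δ) + omega γ δ ε Δ k * t) Δ = b at *
  field_simp
  linear_combination -this

theorem hasDerivAt_eta (hΔ : 0 < Δ.im) {x t : ℂ} (h0 : tau γ δ ε Δ k x t ≠ 0)
    (h1 : tau γ δ ε Δ k (x + δ) t ≠ 0) (h2 : tau γ δ ε Δ k (x + γ) t ≠ 0)
    (h3 : tau γ δ ε Δ k (x + δ - γ) t ≠ 0) :
    HasDerivAt (eta γ δ ε Δ k x) (eta γ δ ε Δ k x t *
      (tauLogDeriv γ δ ε Δ k t x + tauLogDeriv γ δ ε Δ k t (x + δ)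
        - tauLogDeriv γ δ ε Δ k t (x + γ) - tauLogDeriv γ δ ε Δ k t (x + δ - γ))) t := by
  have d := fun x => hasDerivAt_tau (γ := γ) (δ := δ) (ε := ε) (k := k) hΔ x t
  have e := (((d (x + δ - γ)).mul (d (x + γ))).div ((d (x + δ)).mul (d x))
    (mul_ne_zero h1 h0)).const_mul ε
  refine e.congr_deriv ?_
  simp only [eta, tauLogDeriv, Pi.mul_apply]
  field_simp
  ring

theorem analyticAt_eta (hΔ : 0 < Δ.im) {x : ℝ} {t : ℂ} (h0 : tau γ δ ε Δ k x t ≠ 0)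
    (h1 : tau γ δ ε Δ k (x + δ) t ≠ 0) :
    AnalyticAt ℝ (fun p : ℝ × ℂ => eta γ δ ε Δ k p.1 p.2) (x, t) := by
  have hx : AnalyticAt ℝ (fun p : ℝ × ℂ => (p.1 : ℂ)) (x, t) :=
    (ofRealCLM.analyticAt x).fun_comp (f := fun p : ℝ × ℂ => p.1) analyticAt_fst
  have hτ : ∀ c : ℂ, AnalyticAt ℝ (fun p : ℝ × ℂ => tau γ δ ε Δ k (p.1 + c) p.2) (x, t) := by
    intro c
    have h2 : AnalyticAt ℝ (fun p : ℝ × ℂ => (k : ℂ) * (p.1 + c) + omega γ δ ε Δ k * p.2) (x, t) :=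
      (analyticAt_const.fun_mul (hx.fun_add analyticAt_const)).fun_add
        (analyticAt_const.fun_mul analyticAt_snd)
    exact (((differentiable_theta1 hΔ).analyticAt _).restrictScalars (𝕜 := ℝ)).fun_comp
      (f := fun p : ℝ × ℂ => (k : ℂ) * (p.1 + c) + omega γ δ ε Δ k * p.2) h2
  have a0 := hτ 0
  simp only [add_zero] at a0
  have := analyticAt_const (v := ε) |>.fun_mul
    (((hτ (δ - γ)).fun_mul (hτ γ)).fun_div ((hτ δ).fun_mul a0) (mul_ne_zero h1 h0))
  simpa only [eta, add_sub_assoc] using this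

theorem eta_isILWSolution (hδ : δ = ω₂ / ω₁) (hγ : 0 < γ.im) (hγδ : γ.im < δ.im) (hΔ : 0 < Δ.im)
    (hk : k ≠ 0) {η₀ : ℂ} (hb : IsBilinearSolution γ δ ε η₀ (tau γ δ ε Δ k)) :
    IsILWSolution ω₁ ω₂ γ (regularTimes δ (tau γ δ ε Δ k)) (fun x t => eta γ δ ε Δ k x t) := by
  have hδ0 : 0 < δ.im := hγ.trans hγδ
  have hreal : ∀ t ∈ regularTimes δ (tau γ δ ε Δ k), ∀ x : ℝ, tau γ δ ε Δ k x t ≠ 0 :=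
    fun t ht x => ht x (by simp) (by simpa using hδ0.le)
  have htop : ∀ t ∈ regularTimes δ (tau γ δ ε Δ k), ∀ x : ℝ, tau γ δ ε Δ k (x + δ) t ≠ 0 :=
    fun t ht x => ht _ (by simpa using hδ0.le) (by simp)
  refine ⟨fun x t ht => analyticAt_eta hΔ (hreal t ht x) (htop t ht x), fun x t _ => ?_,
    fun x t ht => ?_⟩
  · have := (eta_periodic (γ := γ) (δ := δ) (ε := ε) (Δ := Δ) hk t).1 x
    simpa using this
  · refine ⟨_, ?_, hasDerivAt_eta hΔ (hreal t ht x) (htop t ht x)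
      (ht _ (by simpa using hγ.le) (by simpa using hγδ.le))
      (ht _ (by simpa using hγδ.le) (by simpa using hγ.le))⟩
    have hη : (fun y : ℝ => eta γ δ ε Δ k y t) = fun y : ℝ =>
        tauLogDeriv γ δ ε Δ k t y - tauLogDeriv γ δ ε Δ k t (y + δ) + η₀ :=
      funext fun y => eta_eq_tauLogDeriv_sub hΔ hb (hreal t ht y) (htop t ht y)
    rw [hη]
    have han : ∀ z : ℂ, 0 ≤ z.im → z.im ≤ δ.im → AnalyticAt ℂ (tauLogDeriv γ δ ε Δ k t) z :=
      fun z h1 h2 => analyticAt_tauLogDeriv hΔ (ht z h1 h2)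
    have hper := tauLogDeriv_periodic (γ := γ) (δ := δ) (ε := ε) (Δ := Δ) (k := k) t
    generalize tauLogDeriv γ δ ε Δ k t = w at *
    subst hδ
    exact hasTransform_sub_shift hδ0 hγ hγδ hper han η₀ x

end solution

end EllipticILW

open EllipticILW in
theorem mainTheorem2 (ω₁ ω₂ γ δ ε Δ : ℂ) (k : ℤ)
    (hδ : δ = ω₂ / ω₁) (hδ_pos : 0 < δ.im) (hγ_pos : 0 < γ.im) (hγ_lt : γ.im < δ.im)
    (hΔ : δ.im < Δ.im) (hk : k ≠ 0)
    (hkγ : ∀ m n : ℤ, (k : ℂ) * γ ≠ m + n * Δ)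
    (hkδ : ∀ m n : ℤ, (k : ℂ) * δ ≠ m + n * Δ)
    (hkδγ : ∀ m n : ℤ, (k : ℂ) * (δ - γ) ≠ m + n * Δ) :
    IsBilinearSolution γ δ ε (etaZero γ δ ε Δ k) (tau γ δ ε Δ k) ∧
    (∀ t : ℂ, Meromorphic (fun z => eta γ δ ε Δ k z t) ∧
      Function.Periodic (fun z => eta γ δ ε Δ k z t) 1 ∧
      Function.Periodic (fun z => eta γ δ ε Δ k z t) (Δ / k)) ∧
    IsILWSolution ω₁ ω₂ γ (regularTimes δ (tau γ δ ε Δ k)) (fun x t => eta γ δ ε Δ k x t) ∧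
    IsOpen (regularTimes δ (tau γ δ ε Δ k)) ∧
    (ε ≠ 0 → |(k : ℝ)| * δ.im < Δ.im → (regularTimes δ (tau γ δ ε Δ k)).Nonempty) := by
  have hΔ0 : 0 < Δ.im := hδ_pos.trans hΔ
  have h1 := theta1_ne_zero hΔ0 hkγ
  have h2 := theta1_ne_zero hΔ0 hkδ
  have h3 := theta1_ne_zero hΔ0 hkδγ
  have hb := tau_bilinear (ε := ε) hΔ0 h1 h2 h3
  refine ⟨hb, fun t => ⟨eta_meromorphic hΔ0 t, eta_periodic hk t⟩,
    eta_isILWSolution hδ hγ_pos hγ_lt hΔ0 hk hb, isOpen_regularTimes hΔ0,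
    fun hε h => regularTimes_nonempty hΔ0 ?_ h⟩
  -- The frequency `ω(k)` is nonzero, so a suitable `t` can place the theta argument at any
  -- prescribed height.
  exact mul_ne_zero (neg_ne_zero.2 hε) (div_ne_zero (mul_ne_zero h1 h3)
    (mul_ne_zero (theta1'_ne_zero hΔ0 (theta1_zero Δ)) h2))
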